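/- Let $\pi\colon E\to M$ be a smooth fibre bundle with $\dim M=m$ and $\dim E=m+n$, where $M$ and $E$ are smooth (Hausdorff, second countable) manifolds and $M$ carries a fixed volume form $\eta$. Let $\Lambda^m_2(T^*E)$ (resp. $\Lambda^m_1(T^*E)$) be the bundle of $m$-forms on $E$ that vanish when contracted with any two (resp. any one) $\pi$-vertical vectors, let $J^1\pi^*=\Lambda^m_2(T^*E)/\Lambda^m_1(T^*E)$, with quotient map $\mu\colon\Lambda^m_2(T^*E)\to J^1\pi^*$ and projections $\pi_E\colon\Lambda^m_2(T^*E)\to E$, $\pi^r_E\colon J^1\pi^*\to E$, $\bar\pi^r_E=\pi\circ\pi^r_E\colon J^1\pi^*\to M$. Let $\Theta$ be the tautological $m$-form on $\Lambda^m_2(T^*E)$, $\Theta_\omega(X_1,\dots,X_m)=\omega(T\pi_E X_1,\dots,T\pi_E X_m)$, and $\Omega=-d\Theta$. Let $h$ be a Hamiltonian section, that is, a smooth global section of $\mu$, and put $\Omega_h=h^*\Omega$. Sections of $\pi$ and of $\bar\pi^r_E$ are understood to be smooth local sections, over open subsets of $M$. A local section is an integral section of a distribution if at each of its points the tangent space of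 its image equals the distribution. Let $\mathcal D_h$ be a distribution on $J^1\pi^*$ that solves the Hamiltonian problem: it is $m$-dimensional, transverse to the fibres of $\bar\pi^r_E$ and integrable, and each of its integral sections $\psi$ satisfies $\psi^*i(X)\Omega_h=0$ for every vector field $X$ on $J^1\pi^*$. Let $s$ be a smooth global section of $\pi^r_E$, and let $\mathcal D$ be an $m$-dimensional integrable distribution on $E$ that is transverse to the fibres of $\pi$. Denote by $\{\mathcal X\}$ the set of all nowhere vanishing, locally decomposable $m$-vector fields on $E$ that are sections of $\Lambda^m\mathcal D$, and by $\{\mathcal X_h\}$ the corresponding set for $\mathcal D_h$ on $J^1\pi^*$. Then the following are equivalent. 1. (Generalized Hamiltonian Hamilton-Jacobi condition.) For every local section $\gamma$ of $\pi$ that is an integral section of $\mathcal D$, the local section $s\circ\gamma$ of $\bar\pi^r_E$ is an integral section of $\mathcal D_h$. 2. $\mathcal D$ and $\mathcal D_h$ are $s$-related: for every $\mathcal X_h\in\{\mathcal X_h\}$ there exists $\mathcal X\in\{\mathcal X\}$, and for every $\mathcal X\in\{\mathcal X\}$ there exists $\mathcal X_h\in\{\mathcal X_h\}$, such that $\mathcal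 X_h\circ s=\Lambda^mTs\circ\mathcal X$. -/

import Mathlib

open scoped Manifold Topology ContDiff
open Set

namespace HJ

universe u v

/-- The model space with coordinates `(x, u)`. -/
abbrev AdaptedModel (m n : ℕ) : Type := EuclideanSpace ℝ (Fin m) × EuclideanSpace ℝ (Fin n)

section LinearAlgebra

variable {T : Type*} [AddCommGroup T] [Module ℝ T] [TopologicalSpace T]

/-- The `m`-forms on `T` that vanish on any two vectors of `W`, as a subspace of all `m`-forms. -/
def semibasic₂ (m : ℕ) (W : Submodule ℝ T) : Submodule ℝ (T [⋀^Fin m]→L[ℝ] ℝ) where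
  carrier := {ξ | ∀ (v : Fin m → T) (i j : Fin m), i ≠ j → v i ∈ W → v j ∈ W → ξ v = 0}
  add_mem' := fun {a b} ha hb v i j hij hi hj => by
    simp [ha v i j hij hi hj, hb v i j hij hi hj]
  zero_mem' := fun _ _ _ _ _ _ => rfl
  smul_mem' := fun c a ha v i j hij hi hj => by simp [ha v i j hij hi hj]

/-- The vector space of the `m`-forms on `T` that vanish on any two vectors of `W`. -/
def ExtForm (m : ℕ) (W : Submodule ℝ T) : Type _ := semibasic₂ m W

instance (m : ℕ) (W : Submodule ℝ T) : AddCommGroup (ExtForm m W) :=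
  inferInstanceAs (AddCommGroup (semibasic₂ m W))

instance (m : ℕ) (W : Submodule ℝ T) : Module ℝ (ExtForm m W) :=
  inferInstanceAs (Module ℝ (semibasic₂ m W))

/-- The `m`-forms on `T` that vanish on any vector of `W`. -/
def semibasic₁ (m : ℕ) (W : Submodule ℝ T) : Submodule ℝ (ExtForm m W) where
  carrier := {ξ | ∀ (v : Fin m → T) (i : Fin m), v i ∈ W → ξ.1 v = 0}
  add_mem' := fun {a b} ha hb v i hi => by
    change a.1 v + b.1 v = 0
    rw [ha v i hi, hb v i hi, add_zero]
  zero_mem' := fun _ _ _ => rfl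
  smul_mem' := fun c a ha v i hi => by
    change c • a.1 v = 0
    rw [ha v i hi, smul_zero]

/-- The quotient of the forms that vanish on any two vectors of `W` by those that vanish on any
vector of `W`. -/
def RedForm (m : ℕ) (W : Submodule ℝ T) : Type _ := ExtForm m W ⧸ semibasic₁ m W

instance (m : ℕ) (W : Submodule ℝ T) : AddCommGroup (RedForm m W) :=
  inferInstanceAs (AddCommGroup (ExtForm m W ⧸ semibasic₁ m W))

instance (m : ℕ) (W : Submodule ℝ T) : Module ℝ (RedForm m W) :=
  inferInstanceAs (Module ℝ (ExtForm m W ⧸ semibasic₁ m W))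

variable {m n : ℕ}

/-- The quotient map. -/
def RedForm.mk {W : Submodule ℝ T} : ExtForm m W →ₗ[ℝ] RedForm m W := (semibasic₁ m W).mkQ

/-- The coordinate forms and vectors of the model space. -/
noncomputable def dx (i : Fin m) : AdaptedModel m n →L[ℝ] ℝ :=
  (EuclideanSpace.proj i).comp (ContinuousLinearMap.fst ℝ _ _)

noncomputable def du (α : Fin n) : AdaptedModel m n →L[ℝ] ℝ :=
  (EuclideanSpace.proj α).comp (ContinuousLinearMap.snd ℝ _ _)

noncomputable def ddx (i : Fin m) : AdaptedModel m n := (EuclideanSpace.single i 1, 0)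

noncomputable def ddu (α : Fin n) : AdaptedModel m n := (0, EuclideanSpace.single α 1)

@[simp] theorem dx_ddx (i j : Fin m) : dx i (ddx j : AdaptedModel m n) = if i = j then 1 else 0 := by
  simp [dx, ddx]
@[simp] theorem dx_ddu (i : Fin m) (α : Fin n) : dx i (ddu α : AdaptedModel m n) = 0 := by
  simp [dx, ddu]
@[simp] theorem du_ddx (i : Fin m) (α : Fin n) : du α (ddx i : AdaptedModel m n) = 0 := by
  simp [du, ddx]
@[simp] theorem du_ddu (α β : Fin n) : du α (ddu β : AdaptedModel m n) = if α = β then 1 else 0 := by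
  simp [du, ddu]

/-- The `m`-form `θ ↦ θ 0 ∧ … ∧ θ (m - 1)`, that is, `v ↦ det (θ i (v j))`. -/
noncomputable def wedgeCovectors (θ : Fin m → T →L[ℝ] ℝ) : T [⋀^Fin m]→L[ℝ] ℝ where
  toAlternatingMap := Matrix.detRowAlternating.compLinearMap
    (LinearMap.pi fun i => (θ i : T →ₗ[ℝ] ℝ))
  cont := by
    refine Continuous.matrix_det (continuous_matrix fun j i => ?_)
    exact (θ i).continuous.comp (continuous_apply j)

theorem wedgeCovectors_apply (θ : Fin m → T →L[ℝ] ℝ) (v : Fin m → T) :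
    wedgeCovectors θ v = Matrix.det (Matrix.of fun j i => θ i (v j)) := rfl

/-- Coordinates `(p, p i α)` of an `m`-form. -/
noncomputable def formCoord : (AdaptedModel m n [⋀^Fin m]→L[ℝ] ℝ) →ₗ[ℝ] ℝ × (Fin m → Fin n → ℝ) where
  toFun ξ := (ξ ddx, fun i α => ξ (Function.update ddx i (ddu α)))
  map_add' _ _ := rfl
  map_smul' _ _ := rfl

/-- `p dᵐx + p i α du α ∧ dᵐ⁻¹x i`. -/
noncomputable def coordForm :
    ℝ × (Fin m → Fin n → ℝ) →ₗ[ℝ] (AdaptedModel m n [⋀^Fin m]→L[ℝ] ℝ) where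
  toFun q := q.1 • wedgeCovectors dx +
    ∑ i, ∑ α, q.2 i α • wedgeCovectors (Function.update dx i (du α))
  map_add' q r := by
    simp [add_smul, Finset.sum_add_distrib]; abel
  map_smul' c q := by
    simp [Finset.smul_sum, smul_smul]

abbrev verticalModel (m n : ℕ) : Submodule ℝ (AdaptedModel m n) :=
  LinearMap.ker (LinearMap.fst ℝ (EuclideanSpace ℝ (Fin m)) (EuclideanSpace ℝ (Fin n)))

theorem dx_of_mem {v : AdaptedModel m n} (h : v ∈ verticalModel m n) (i : Fin m) : dx i v = 0 := by
  have : v.1 = 0 := h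
  simp [dx, this]

theorem ddu_mem (α : Fin n) : (ddu α : AdaptedModel m n) ∈ verticalModel m n := by
  simp [ddu]

theorem coordForm_mem (q : ℝ × (Fin m → Fin n → ℝ)) :
    coordForm q ∈ semibasic₂ m (verticalModel m n) := by
  have key : ∀ (θ : Fin m → AdaptedModel m n →L[ℝ] ℝ) (v : Fin m → AdaptedModel m n) (a b : Fin m)
      (k : Fin m), a ≠ b → (∀ i, i ≠ k → θ i (v a) = 0) → (∀ i, i ≠ k → θ i (v b) = 0) →
      wedgeCovectors θ v = 0 := by
    intro θ v a b k hab ha hb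
    rw [wedgeCovectors_apply]
    by_cases h0 : θ k (v a) = 0
    · refine Matrix.det_eq_zero_of_row_eq_zero a fun i => ?_
      by_cases hi : i = k
      · subst hi; exact h0
      · exact ha i hi
    · have h1 := Matrix.det_updateRow_add_smul_self (Matrix.of fun j i => θ i (v j)) hab.symm
        (-(θ k (v b)) / θ k (v a))
      rw [← h1]
      refine Matrix.det_eq_zero_of_row_eq_zero b fun i => ?_
      rw [Matrix.updateRow_self]
      by_cases hi : i = k
      · subst hi; simp; field_simp; ring
      · simp [ha i hi, hb i hi]
  intro v a b hab ha hb
  have h1 : wedgeCovectors (dx : Fin m → AdaptedModel m n →L[ℝ] ℝ) v = 0 :=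
    key _ v a b a hab (fun i _ => dx_of_mem ha i) (fun i _ => dx_of_mem hb i)
  have h2 : ∀ i α, wedgeCovectors (Function.update (dx : Fin m → AdaptedModel m n →L[ℝ] ℝ) i (du α)) v = 0 := by
    intro i α
    refine key _ v a b i hab (fun k hk => ?_) (fun k hk => ?_) <;>
      rw [Function.update_of_ne hk]
    · exact dx_of_mem ha k
    · exact dx_of_mem hb k
  simp [coordForm, ContinuousAlternatingMap.sum_apply, h1, h2]

theorem formCoord_coordForm (q : ℝ × (Fin m → Fin n → ℝ)) : formCoord (coordForm q) = q := by
  have h11 : wedgeCovectors (dx : Fin m → AdaptedModel m n →L[ℝ] ℝ) ddx = 1 := by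
    rw [wedgeCovectors_apply]
    convert Matrix.det_one (n := Fin m) (R := ℝ)
    ext j i
    simp [Matrix.one_apply, eq_comm]
  have h12 : ∀ i (α : Fin n), wedgeCovectors (Function.update (dx : Fin m → AdaptedModel m n →L[ℝ] ℝ) i (du α)) ddx = 0 := by
    intro i α
    rw [wedgeCovectors_apply]
    refine Matrix.det_eq_zero_of_column_eq_zero i fun j => ?_
    simp
  have h21 : ∀ i (α : Fin n), wedgeCovectors (dx : Fin m → AdaptedModel m n →L[ℝ] ℝ) (Function.update ddx i (ddu α)) = 0 := by
    intro i α
    rw [wedgeCovectors_apply]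
    refine Matrix.det_eq_zero_of_row_eq_zero i fun j => ?_
    simp
  have h22 : ∀ k (β : Fin n) i (α : Fin n), wedgeCovectors (Function.update (dx : Fin m → AdaptedModel m n →L[ℝ] ℝ) k (du β))
      (Function.update ddx i (ddu α)) = if k = i ∧ β = α then 1 else 0 := by
    intro k β i α
    rw [wedgeCovectors_apply]
    by_cases hk : k = i
    · subst hk
      rw [← Matrix.det_transpose]
      have : (Matrix.of fun j i => (Function.update (dx : Fin m → AdaptedModel m n →L[ℝ] ℝ) k (du β)) i
          ((Function.update ddx k (ddu α) : Fin m → AdaptedModel m n) j)).transpose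
          = Matrix.diagonal (fun j => if j = k then (if β = α then 1 else 0) else 1) := by
        ext a b
        simp only [Matrix.transpose_apply, Matrix.of_apply, Matrix.diagonal_apply]
        by_cases ha : a = k <;> by_cases hb : b = k
        · subst ha; subst hb; simp
        · subst ha; simp [Function.update_of_ne hb, Ne.symm hb]
        · subst hb; simp [ha]
        · simp [Function.update_of_ne hb, ha]
      rw [this, Matrix.det_diagonal, Finset.prod_ite_eq' ]
      simp
    · rw [if_neg (fun h => hk h.1)]
      refine Matrix.det_eq_zero_of_column_eq_zero i fun j => ?_
      rw [Matrix.of_apply, Function.update_of_ne (Ne.symm hk)]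
      by_cases hj : j = i
      · subst hj; simp
      · simp [Function.update_of_ne hj, Ne.symm hj]
  ext
  · simp [formCoord, coordForm, ContinuousAlternatingMap.sum_apply, h11, h12]
  · rename_i i α
    simp [formCoord, coordForm, ContinuousAlternatingMap.sum_apply, h21, h22, ite_and]

theorem eq_zero_of_formCoord_eq_zero {ξ : AdaptedModel m n [⋀^Fin m]→L[ℝ] ℝ}
    (hξ : ξ ∈ semibasic₂ m (verticalModel m n)) (h : formCoord ξ = 0) : ξ = 0 := by
  classical
  have h0 : ξ ddx = 0 := congrArg Prod.fst h
  have h1 : ∀ i α, ξ (Function.update ddx i (ddu α)) = 0 := fun i α =>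
    congrFun (congrFun (congrArg Prod.snd h) i) α
  let b : Module.Basis (Fin m ⊕ Fin n) ℝ (AdaptedModel m n) :=
    (EuclideanSpace.basisFun (Fin m) ℝ).toBasis.prod (EuclideanSpace.basisFun (Fin n) ℝ).toBasis
  have bl : ∀ i, b (Sum.inl i) = ddx i := fun i => by simp [b, ddx]
  have br : ∀ α, b (Sum.inr α) = ddu α := fun α => by simp [b, ddu]
  have hperm : ∀ (w : Fin m → AdaptedModel m n) (σ : Equiv.Perm (Fin m)), ξ w = 0 →
      ξ (fun k => w (σ k)) = 0 := by
    intro w σ hw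
    have := ξ.toAlternatingMap.map_perm w σ
    have h2 : ξ (w ∘ σ) = Equiv.Perm.sign σ • ξ w := this
    rw [hw, smul_zero] at h2
    exact h2
  apply ContinuousAlternatingMap.toAlternatingMap_injective
  refine Module.Basis.ext_alternating b fun v hv => ?_
  change ξ (fun i => b (v i)) = 0
  by_cases hall : ∀ k, ∃ i, v k = Sum.inl i
  · choose σ hσ using hall
    have hinj : Function.Injective σ := fun a c hac => hv (by rw [hσ, hσ, hac])
    have := hperm ddx (Equiv.ofBijective σ (Finite.injective_iff_bijective.1 hinj)) h0
    convert this using 2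
    ext1 k
    rw [hσ, bl]; rfl
  · push Not at hall
    obtain ⟨j, hj⟩ := hall
    obtain ⟨α, hα⟩ : ∃ α, v j = Sum.inr α := by
      cases hvj : v j with
      | inl i => exact absurd hvj (hj i)
      | inr α => exact ⟨α, rfl⟩
    by_cases hone : ∀ k, k ≠ j → ∃ i, v k = Sum.inl i
    · choose! σ hσ using hone
      have hinj : Set.InjOn σ (↑(Finset.univ.erase j) : Set (Fin m)) := fun a ha c hc hac =>
        hv (by rw [hσ a (by simpa using ha), hσ c (by simpa using hc), hac])
      obtain ⟨i, hi⟩ : ∃ i, i ∉ (Finset.univ.erase j).image σ := by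
        by_contra hcon
        push Not at hcon
        have h3 : ((Finset.univ.erase j).image σ) = Finset.univ :=
          Finset.eq_univ_iff_forall.2 hcon
        have h4 := congrArg Finset.card h3
        rw [Finset.card_image_of_injOn hinj, Finset.card_erase_of_mem (Finset.mem_univ _),
          Finset.card_univ, Fintype.card_fin] at h4
        have := j.pos
        omega
      have hi' : ∀ k, k ≠ j → σ k ≠ i := fun k hk hki =>
        hi (Finset.mem_image.2 ⟨k, by simpa using hk, hki⟩)
      have hτ : Function.Injective (Function.update σ j i) := by
        intro a c hac
        by_cases ha : a = j <;> by_cases hc : c = j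
        · rw [ha, hc]
        · subst ha
          rw [Function.update_self, Function.update_of_ne hc] at hac
          exact absurd hac.symm (hi' c hc)
        · subst hc
          rw [Function.update_self, Function.update_of_ne ha] at hac
          exact absurd hac (hi' a ha)
        · rw [Function.update_of_ne hc, Function.update_of_ne ha] at hac
          exact hinj (by simpa using ha) (by simpa using hc) hac
      have := hperm (Function.update ddx i (ddu α))
        (Equiv.ofBijective _ (Finite.injective_iff_bijective.1 hτ)) (h1 i α)
      convert this using 2
      ext1 k
      rw [Equiv.ofBijective_apply]
      by_cases hk : k = j
      · subst hk
        rw [Function.update_self, Function.update_self, hα, br]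
      · rw [Function.update_of_ne hk, Function.update_of_ne (hi' k hk), hσ k hk, bl]
    · push Not at hone
      obtain ⟨k, hkj, hk⟩ := hone
      obtain ⟨β, hβ⟩ : ∃ β, v k = Sum.inr β := by
        cases hvk : v k with
        | inl i => exact absurd hvk (hk i)
        | inr β => exact ⟨β, rfl⟩
      refine hξ _ k j hkj ?_ ?_
      · rw [hβ, br]; exact ddu_mem β
      · rw [hα, br]; exact ddu_mem α

theorem coordForm_formCoord {ξ : AdaptedModel m n [⋀^Fin m]→L[ℝ] ℝ}
    (hξ : ξ ∈ semibasic₂ m (verticalModel m n)) : coordForm (formCoord ξ) = ξ := by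
  rw [← sub_eq_zero]
  refine eq_zero_of_formCoord_eq_zero (Submodule.sub_mem _ (coordForm_mem _) hξ) ?_
  rw [map_sub, formCoord_coordForm, sub_self]

theorem formCoord_snd_eq_zero_iff {ξ : AdaptedModel m n [⋀^Fin m]→L[ℝ] ℝ}
    (hξ : ξ ∈ semibasic₂ m (verticalModel m n)) :
    (formCoord ξ).2 = 0 ↔ ∀ (v : Fin m → AdaptedModel m n) (i : Fin m),
      v i ∈ verticalModel m n → ξ v = 0 := by
  constructor
  · intro h v i hi
    have h1 : wedgeCovectors (dx : Fin m → AdaptedModel m n →L[ℝ] ℝ) v = 0 := by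
      rw [wedgeCovectors_apply]
      exact Matrix.det_eq_zero_of_row_eq_zero i fun j => dx_of_mem hi j
    rw [← coordForm_formCoord hξ]
    simp [coordForm, h, h1]
  · intro h
    ext i α
    exact h _ i (by rw [Function.update_self]; exact ddu_mem α)

theorem comp_mem_semibasic₂ {T' : Type*} [AddCommGroup T'] [Module ℝ T'] [TopologicalSpace T']
    {W : Submodule ℝ T} {W' : Submodule ℝ T'} (A : T →L[ℝ] T') (hA : ∀ v ∈ W, A v ∈ W')
    {ξ : T' [⋀^Fin m]→L[ℝ] ℝ} (hξ : ξ ∈ semibasic₂ m W') :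
    ξ.compContinuousLinearMap A ∈ semibasic₂ m W :=
  fun v i j hij hi hj => hξ (fun k => A (v k)) i j hij (hA _ hi) (hA _ hj)

/-- The coordinates `(p, p i α)` on the `m`-forms on `T` that vanish on any two vectors of `W`,
given by an isomorphism of `T` with the model that takes `W` to the vertical vectors. -/
noncomputable def extCoordEquiv {W : Submodule ℝ T} (A : T ≃L[ℝ] AdaptedModel m n)
    (hA : ∀ v, v ∈ W ↔ A v ∈ verticalModel m n) :
    ExtForm m W ≃ₗ[ℝ] ℝ × (Fin m → Fin n → ℝ) where
  toFun ξ := formCoord (ξ.1.compContinuousLinearMap (A.symm : AdaptedModel m n →L[ℝ] T))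
  map_add' _ _ := rfl
  map_smul' _ _ := rfl
  invFun q := ⟨(coordForm q).compContinuousLinearMap (A : T →L[ℝ] AdaptedModel m n),
    comp_mem_semibasic₂ _ (fun v hv => (hA v).1 hv) (coordForm_mem q)⟩
  left_inv ξ := by
    apply Subtype.ext
    have h := comp_mem_semibasic₂ (A.symm : AdaptedModel m n →L[ℝ] T)
      (fun v hv => (hA _).2 (by rw [ContinuousLinearEquiv.coe_coe, A.apply_symm_apply]; exact hv)) ξ.2
    change (coordForm (formCoord _)).compContinuousLinearMap _ = _
    rw [coordForm_formCoord h]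
    ext v
    simp [Function.comp_def]
  right_inv q := by
    change formCoord (ContinuousAlternatingMap.compContinuousLinearMap
      ((coordForm q).compContinuousLinearMap _) _) = q
    conv_rhs => rw [← formCoord_coordForm q]
    congr 1
    ext v
    simp [Function.comp_def]

theorem extCoordEquiv_snd_eq_zero_iff {W : Submodule ℝ T} (A : T ≃L[ℝ] AdaptedModel m n)
    (hA : ∀ v, v ∈ W ↔ A v ∈ verticalModel m n) (ξ : ExtForm m W) :
    (extCoordEquiv A hA ξ).2 = 0 ↔ ξ ∈ semibasic₁ m W := by
  have h := comp_mem_semibasic₂ (A.symm : AdaptedModel m n →L[ℝ] T)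
      (fun v hv => (hA _).2 (by rw [ContinuousLinearEquiv.coe_coe, A.apply_symm_apply]; exact hv)) ξ.2
  refine (formCoord_snd_eq_zero_iff h).trans ⟨fun h1 v i hi => ?_, fun h1 v i hi => ?_⟩
  · have := h1 (fun k => A (v k)) i ((hA _).1 hi)
    simpa [Function.comp_def] using this
  · exact h1 (fun k => A.symm (v k)) i ((hA _).2 (by rw [A.apply_symm_apply]; exact hi))

/-- The coordinates `p i α` on the quotient. -/
noncomputable def redCoordEquiv {W : Submodule ℝ T} (A : T ≃L[ℝ] AdaptedModel m n)
    (hA : ∀ v, v ∈ W ↔ A v ∈ verticalModel m n) :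
    RedForm m W ≃ₗ[ℝ] (Fin m → Fin n → ℝ) :=
  (Submodule.quotEquivOfEq _
    (LinearMap.ker (LinearMap.snd ℝ ℝ (Fin m → Fin n → ℝ) ∘ₗ (extCoordEquiv A hA).toLinearMap))
    (by
      ext ξ
      exact (extCoordEquiv_snd_eq_zero_iff A hA ξ).symm)).trans
  (LinearMap.quotKerEquivOfSurjective _ (by
    intro p
    exact ⟨(extCoordEquiv A hA).symm (0, p), by simp⟩))

theorem redCoordEquiv_mk {W : Submodule ℝ T} (A : T ≃L[ℝ] AdaptedModel m n)
    (hA : ∀ v, v ∈ W ↔ A v ∈ verticalModel m n) (ξ : ExtForm m W) :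
    redCoordEquiv A hA (RedForm.mk ξ) = (extCoordEquiv A hA ξ).2 := rfl

theorem redCoordEquiv_symm {W : Submodule ℝ T} (A : T ≃L[ℝ] AdaptedModel m n)
    (hA : ∀ v, v ∈ W ↔ A v ∈ verticalModel m n) (p : Fin m → Fin n → ℝ) :
    (redCoordEquiv A hA).symm p = RedForm.mk ((extCoordEquiv A hA).symm (0, p)) := by
  rw [LinearEquiv.symm_apply_eq, redCoordEquiv_mk, LinearEquiv.apply_symm_apply]

/-- The linear change of the coordinates `(p, p i α)` that a linear map of the model induces. -/
noncomputable def extTransition (B : AdaptedModel m n →L[ℝ] AdaptedModel m n) :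
    (ℝ × (Fin m → Fin n → ℝ)) →L[ℝ] (ℝ × (Fin m → Fin n → ℝ)) :=
  LinearMap.toContinuousLinearMap
    { toFun := fun q => formCoord ((coordForm q).compContinuousLinearMap B)
      map_add' := fun q r => by rw [map_add]; rfl
      map_smul' := fun c q => by rw [map_smul]; rfl }

theorem contDiff_coordForm_apply (q : ℝ × (Fin m → Fin n → ℝ)) (w : Fin m → AdaptedModel m n) :
    ContDiff ℝ ∞ fun B : AdaptedModel m n →L[ℝ] AdaptedModel m n =>
      coordForm q (fun i => B (w i)) := by
  have h : ∀ θ : Fin m → AdaptedModel m n →L[ℝ] ℝ, ContDiff ℝ ∞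
      fun B : AdaptedModel m n →L[ℝ] AdaptedModel m n => wedgeCovectors θ (fun i => B (w i)) := by
    intro θ
    simp only [wedgeCovectors_apply, Matrix.det_apply, Matrix.of_apply]
    refine ContDiff.sum fun σ _ => ContDiff.const_smul _ (contDiff_prod fun i _ => ?_)
    exact (θ _).contDiff.comp (contDiff_id.clm_apply contDiff_const)
  simp only [coordForm, LinearMap.coe_mk, AddHom.coe_mk, ContinuousAlternatingMap.add_apply,
    ContinuousAlternatingMap.sum_apply, ContinuousAlternatingMap.smul_apply]
  exact (ContDiff.const_smul _ (h _)).add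
    (ContDiff.sum fun i _ => ContDiff.sum fun α _ => ContDiff.const_smul _ (h _))

theorem contDiff_extTransition : ContDiff ℝ ∞ (extTransition (m := m) (n := n)) := by
  rw [contDiff_clm_apply_iff]
  intro q
  refine ContDiff.prodMk ?_ (contDiff_pi.2 fun i => contDiff_pi.2 fun α => ?_)
  · exact contDiff_coordForm_apply q ddx
  · exact contDiff_coordForm_apply q (Function.update ddx i (ddu α))

noncomputable def redTransition (B : AdaptedModel m n →L[ℝ] AdaptedModel m n) :
    (Fin m → Fin n → ℝ) →L[ℝ] (Fin m → Fin n → ℝ) :=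
  (ContinuousLinearMap.snd ℝ ℝ (Fin m → Fin n → ℝ)).comp
    ((extTransition B).comp (ContinuousLinearMap.inr ℝ ℝ (Fin m → Fin n → ℝ)))

theorem contDiff_redTransition : ContDiff ℝ ∞ (redTransition (m := m) (n := n)) :=
  contDiff_const.clm_comp (contDiff_extTransition.clm_comp contDiff_const)

theorem extTransition_apply {W : Submodule ℝ T} (A A' : T ≃L[ℝ] AdaptedModel m n)
    (hA : ∀ v, v ∈ W ↔ A v ∈ verticalModel m n) (hA' : ∀ v, v ∈ W ↔ A' v ∈ verticalModel m n)
    (q : ℝ × (Fin m → Fin n → ℝ)) :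
    extTransition ((A : T →L[ℝ] AdaptedModel m n).comp (A'.symm : AdaptedModel m n →L[ℝ] T)) q =
      extCoordEquiv A' hA' ((extCoordEquiv A hA).symm q) := rfl

theorem redTransition_apply {W : Submodule ℝ T} (A A' : T ≃L[ℝ] AdaptedModel m n)
    (hA : ∀ v, v ∈ W ↔ A v ∈ verticalModel m n) (hA' : ∀ v, v ∈ W ↔ A' v ∈ verticalModel m n)
    (p : Fin m → Fin n → ℝ) :
    redTransition ((A : T →L[ℝ] AdaptedModel m n).comp (A'.symm : AdaptedModel m n →L[ℝ] T)) p =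
      redCoordEquiv A' hA' ((redCoordEquiv A hA).symm p) := by
  rw [redCoordEquiv_symm, redCoordEquiv_mk]; rfl

end LinearAlgebra

section FiberBundles

variable {M : Type u} {E : Type v} {m n : ℕ}
  [TopologicalSpace M] [ChartedSpace (EuclideanSpace ℝ (Fin m)) M]
  [TopologicalSpace E] [ChartedSpace (EuclideanSpace ℝ (Fin (m + n))) E]

/-- `π : E → M` is a smooth fibre bundle with `dim M = m` and `dim E = m + n`: it is locally
trivial, with smooth local trivializations and an `n`-dimensional manifold as the fibre. -/
class IsSmoothFiberBundle (m n : ℕ) {M : Type u} {E : Type v}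
    [TopologicalSpace M] [ChartedSpace (EuclideanSpace ℝ (Fin m)) M]
    [TopologicalSpace E] [ChartedSpace (EuclideanSpace ℝ (Fin (m + n))) E]
    (π : E → M) : Prop where
  exists_trivialization : ∃ (F : Type v) (_ : TopologicalSpace F)
    (_ : ChartedSpace (EuclideanSpace ℝ (Fin n)) F), IsManifold (𝓡 n) ∞ F ∧
    ∀ x : M, ∃ t : Bundle.Trivialization F π, x ∈ t.baseSet ∧
      ContMDiffOn (𝓡 (m + n)) ((𝓡 m).prod (𝓡 n)) ∞ t t.source ∧
      ContMDiffOn ((𝓡 m).prod (𝓡 n)) (𝓡 (m + n)) ∞ t.toOpenPartialHomeomorph.symm t.target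

/-- A chart `(x, u)` of `E` that is adapted to `π`: the coordinates `x` come from a chart of `M`. -/
structure AdaptedChart (m n : ℕ) {M : Type u} {E : Type v}
    [TopologicalSpace M] [ChartedSpace (EuclideanSpace ℝ (Fin m)) M]
    [TopologicalSpace E] [ChartedSpace (EuclideanSpace ℝ (Fin (m + n))) E]
    (π : E → M) where
  chart : OpenPartialHomeomorph E (AdaptedModel m n)
  contMDiffOn_chart :
    ContMDiffOn (𝓡 (m + n)) 𝓘(ℝ, AdaptedModel m n) ∞ chart chart.source
  contMDiffOn_symm :
    ContMDiffOn 𝓘(ℝ, AdaptedModel m n) (𝓡 (m + n)) ∞ chart.symm chart.target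
  base : OpenPartialHomeomorph M (EuclideanSpace ℝ (Fin m))
  contMDiffOn_base : ContMDiffOn (𝓡 m) (𝓡 m) ∞ base base.source
  contMDiffOn_base_symm : ContMDiffOn (𝓡 m) (𝓡 m) ∞ base.symm base.target
  mapsTo : ∀ u ∈ chart.source, π u ∈ base.source
  fst_chart : ∀ u ∈ chart.source, (chart u).1 = base (π u)

theorem IsSmoothFiberBundle.contMDiff (π : E → M) [IsSmoothFiberBundle m n π] :
    ContMDiff (𝓡 (m + n)) (𝓡 m) ∞ π := by
  obtain ⟨F, _, _, _, hF⟩ := IsSmoothFiberBundle.exists_trivialization (m := m) (n := n) (π := π)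
  intro u
  obtain ⟨t, hx, ht, -⟩ := hF (π u)
  have hu : u ∈ t.source := t.mem_source.2 hx
  have h1 : ContMDiffAt (𝓡 (m + n)) (𝓡 m) ∞ (fun z => (t z).1) u :=
    (ht.contMDiffAt (t.open_source.mem_nhds hu)).fst
  refine h1.congr_of_eventuallyEq ?_
  filter_upwards [t.open_source.mem_nhds hu] with z hz
  exact (t.coe_fst hz).symm

theorem exists_adaptedChart [IsManifold (𝓡 m) ∞ M]
    (π : E → M) [IsSmoothFiberBundle m n π] (u : E) :
    ∃ e : AdaptedChart m n π, u ∈ e.chart.source := by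
  obtain ⟨F, _, _, _, hF⟩ := IsSmoothFiberBundle.exists_trivialization (m := m) (n := n) (π := π)
  obtain ⟨t, hx, ht, hts⟩ := hF (π u)
  let φ := chartAt (EuclideanSpace ℝ (Fin m)) (π u)
  let ψ := chartAt (EuclideanSpace ℝ (Fin n)) (t u).2
  have hφ : ContMDiffOn (𝓡 m) (𝓡 m) ∞ φ φ.source := contMDiffOn_chart
  have hφs : ContMDiffOn (𝓡 m) (𝓡 m) ∞ φ.symm φ.target := contMDiffOn_chart_symm
  have hψ : ContMDiffOn (𝓡 n) (𝓡 n) ∞ ψ ψ.source := contMDiffOn_chart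
  have hψs : ContMDiffOn (𝓡 n) (𝓡 n) ∞ ψ.symm ψ.target := contMDiffOn_chart_symm
  let c : OpenPartialHomeomorph E (AdaptedModel m n) := t.toOpenPartialHomeomorph.trans (φ.prod ψ)
  have hcs : ∀ z, z ∈ c.source ↔ z ∈ t.source ∧ (t z).1 ∈ φ.source ∧ (t z).2 ∈ ψ.source := by
    intro z
    simp only [c, OpenPartialHomeomorph.trans_source]
    rfl
  have hct : ∀ z, z ∈ c.target ↔ (z.1 ∈ φ.target ∧ z.2 ∈ ψ.target) ∧
      (φ.symm z.1, ψ.symm z.2) ∈ t.target := by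
    intro z
    simp only [c, OpenPartialHomeomorph.trans_target]
    rfl
  refine ⟨⟨c, ?_, ?_, φ, hφ, hφs, ?_, ?_⟩, ?_⟩
  · refine ContMDiffOn.prodMk_space (f := fun z => φ (t z).1) (g := fun z => ψ (t z).2) ?_ ?_
    · exact hφ.comp (contMDiff_fst.comp_contMDiffOn (ht.mono fun z hz => ((hcs z).1 hz).1))
        (fun z hz => ((hcs z).1 hz).2.1)
    · exact hψ.comp (contMDiff_snd.comp_contMDiffOn (ht.mono fun z hz => ((hcs z).1 hz).1))
        (fun z hz => ((hcs z).1 hz).2.2)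
  · have h1 : ContMDiffOn 𝓘(ℝ, AdaptedModel m n) (𝓡 m) ∞
        (fun z : AdaptedModel m n => φ.symm z.1) c.target :=
      hφs.comp (contDiff_fst.contMDiff.contMDiffOn) (fun z hz => ((hct z).1 hz).1.1)
    have h2 : ContMDiffOn 𝓘(ℝ, AdaptedModel m n) (𝓡 n) ∞
        (fun z : AdaptedModel m n => ψ.symm z.2) c.target :=
      hψs.comp (contDiff_snd.contMDiff.contMDiffOn) (fun z hz => ((hct z).1 hz).1.2)
    exact hts.comp (h1.prodMk h2) (fun z hz => ((hct z).1 hz).2)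
  · intro z hz
    have h := (hcs z).1 hz
    rw [← t.coe_fst h.1]; exact h.2.1
  · intro z hz
    have h := (hcs z).1 hz
    change φ (t z).1 = _
    rw [t.coe_fst h.1]
  · rw [hcs]
    have hu : u ∈ t.source := t.mem_source.2 hx
    refine ⟨hu, ?_, mem_chart_source _ _⟩
    rw [t.coe_fst hu]; exact mem_chart_source _ _

/-- The vertical subspace `V_u π` of `T_u E`. -/
noncomputable abbrev vertical (m n : ℕ) {M : Type u} {E : Type v}
    [TopologicalSpace M] [ChartedSpace (EuclideanSpace ℝ (Fin m)) M]
    [TopologicalSpace E] [ChartedSpace (EuclideanSpace ℝ (Fin (m + n))) E]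
    (π : E → M) (u : E) : Submodule ℝ (TangentSpace (𝓡 (m + n)) u) :=
  LinearMap.ker (mfderiv (𝓡 (m + n)) (𝓡 m) π u).toLinearMap

namespace AdaptedChart

variable {π : E → M} 

theorem mdifferentiable (e : AdaptedChart m n π) :
    e.chart.MDifferentiable (𝓡 (m + n)) 𝓘(ℝ, AdaptedModel m n) :=
  ⟨e.contMDiffOn_chart.mdifferentiableOn (by simp), e.contMDiffOn_symm.mdifferentiableOn (by simp)⟩

/-- The isomorphism of `T_u E` with the model space that an adapted chart at `u` gives. -/
noncomputable def tangentEquiv (e : AdaptedChart m n π) (u : E) (hu : u ∈ e.chart.source) :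
    TangentSpace (𝓡 (m + n)) u ≃L[ℝ] AdaptedModel m n :=
  e.mdifferentiable.mfderiv hu

theorem mem_vertical_iff [IsSmoothFiberBundle m n π] (e : AdaptedChart m n π) (u : E)
    (hu : u ∈ e.chart.source) (v : TangentSpace (𝓡 (m + n)) u) :
    v ∈ vertical m n π u ↔ e.tangentEquiv u hu v ∈ verticalModel m n := by
  have hb : e.base.MDifferentiable (𝓡 m) (𝓡 m) :=
    ⟨e.contMDiffOn_base.mdifferentiableOn (by simp),
      e.contMDiffOn_base_symm.mdifferentiableOn (by simp)⟩
  have h1 : HasMFDerivAt (𝓡 (m + n)) 𝓘(ℝ, AdaptedModel m n) e.chart u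
      (mfderiv (𝓡 (m + n)) 𝓘(ℝ, AdaptedModel m n) e.chart u) :=
    (e.mdifferentiable.mdifferentiableAt hu).hasMFDerivAt
  have h2 : HasMFDerivAt (𝓡 (m + n)) (𝓡 m) (fun z => (e.chart z).1) u
      ((ContinuousLinearMap.fst ℝ _ _).comp
        (mfderiv (𝓡 (m + n)) 𝓘(ℝ, AdaptedModel m n) e.chart u)) :=
    HasMFDerivAt.comp u
      (hasFDerivAt_fst (𝕜 := ℝ) (p := e.chart u)).hasMFDerivAt h1
  have h3 : HasMFDerivAt (𝓡 (m + n)) (𝓡 m) (fun z => e.base (π z)) u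
      ((mfderiv (𝓡 m) (𝓡 m) e.base (π u)).comp (mfderiv (𝓡 (m + n)) (𝓡 m) π u)) :=
    HasMFDerivAt.comp u (hb.mdifferentiableAt (e.mapsTo u hu)).hasMFDerivAt
      ((IsSmoothFiberBundle.contMDiff π).mdifferentiable (by simp) u).hasMFDerivAt
  have h4 := h3.congr_of_eventuallyEq (f₁ := fun z => (e.chart z).1) (by
    filter_upwards [e.chart.open_source.mem_nhds hu] with z hz using e.fst_chart z hz)
  have h5 := hasMFDerivAt_unique h2 h4
  have h6 : (e.tangentEquiv u hu v).1 = mfderiv (𝓡 m) (𝓡 m) e.base (π u)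
      (mfderiv (𝓡 (m + n)) (𝓡 m) π u v) := DFunLike.congr_fun h5 v
  change mfderiv (𝓡 (m + n)) (𝓡 m) π u v = 0 ↔ (e.tangentEquiv u hu v).1 = 0
  rw [h6]
  exact (map_eq_zero_iff (mfderiv (𝓡 m) (𝓡 m) e.base (π u))
    (hb.mfderiv_injective (e.mapsTo u hu))).symm

/-- The Jacobian of the change from `e'` to `e`, at the point `u`. -/
noncomputable def jacobian (e e' : AdaptedChart m n π) (u : E) :
    AdaptedModel m n →L[ℝ] AdaptedModel m n :=
  fderiv ℝ (e.chart ∘ e'.chart.symm) (e'.chart u)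

theorem jacobian_eq (e e' : AdaptedChart m n π) (u : E) (hu : u ∈ e.chart.source)
    (hu' : u ∈ e'.chart.source) :
    jacobian e e' u = ((e.tangentEquiv u hu : TangentSpace (𝓡 (m + n)) u →L[ℝ] AdaptedModel m n).comp
      ((e'.tangentEquiv u hu').symm : AdaptedModel m n →L[ℝ] TangentSpace (𝓡 (m + n)) u)) := by
  have h0 : e'.chart.symm (e'.chart u) = u := e'.chart.left_inv hu'
  have h1 := (e'.mdifferentiable.mdifferentiableAt_symm (e'.chart.map_source hu')).hasMFDerivAt
  have h2 : HasMFDerivAt (𝓡 (m + n)) 𝓘(ℝ, AdaptedModel m n) e.chart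
      (e'.chart.symm (e'.chart u)) (mfderiv (𝓡 (m + n)) 𝓘(ℝ, AdaptedModel m n) e.chart u) := by
    rw [h0]
    exact (e.mdifferentiable.mdifferentiableAt hu).hasMFDerivAt
  have h3 : HasMFDerivAt 𝓘(ℝ, AdaptedModel m n) 𝓘(ℝ, AdaptedModel m n) (e.chart ∘ e'.chart.symm)
      (e'.chart u) _ := HasMFDerivAt.comp _ h2 h1
  exact mfderiv_eq_fderiv.symm.trans h3.mfderiv

theorem contMDiffOn_jacobian (e e' : AdaptedChart m n π) :
    ContMDiffOn (𝓡 (m + n)) 𝓘(ℝ, AdaptedModel m n →L[ℝ] AdaptedModel m n) ∞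
      (jacobian e e') (e.chart.source ∩ e'.chart.source) := by
  let S : Set (AdaptedModel m n) := e'.chart.target ∩ e'.chart.symm ⁻¹' e.chart.source
  have hS : IsOpen S := e'.chart.isOpen_inter_preimage_symm e.chart.open_source
  have h1 : ContDiffOn ℝ ∞ (e.chart ∘ e'.chart.symm) S := by
    rw [← contMDiffOn_iff_contDiffOn]
    exact e.contMDiffOn_chart.comp (e'.contMDiffOn_symm.mono inter_subset_left)
      (fun z hz => hz.2)
  have h2 : ContDiffOn ℝ ∞ (fderiv ℝ (e.chart ∘ e'.chart.symm)) S :=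
    h1.fderiv_of_isOpen hS (by simp)
  refine h2.contMDiffOn.comp (e'.contMDiffOn_chart.mono inter_subset_right) ?_
  intro u hu
  exact ⟨e'.chart.map_source hu.2, by
    change e'.chart.symm (e'.chart u) ∈ e.chart.source
    rw [e'.chart.left_inv hu.2]; exact hu.1⟩

end AdaptedChart

section Prebundle

variable {π : E → M} {Fib : E → Type*} [∀ u, AddCommGroup (Fib u)] [∀ u, Module ℝ (Fib u)]
  {F₀ : Type*} [NormedAddCommGroup F₀] [NormedSpace ℝ F₀]

open Classical in
/-- The local trivialization of a family of vector spaces over `E` that an adapted chart gives,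
if the chart yields coordinates `L` on each fibre. -/
noncomputable def pretriv (e : AdaptedChart m n π)
    (L : ∀ u, u ∈ e.chart.source → (Fib u ≃ₗ[ℝ] F₀)) :
    Bundle.Pretrivialization F₀ (Bundle.TotalSpace.proj : Bundle.TotalSpace F₀ Fib → E) where
  toFun z := (z.1, if h : z.1 ∈ e.chart.source then L z.1 h z.2 else 0)
  invFun w := ⟨w.1, if h : w.1 ∈ e.chart.source then (L w.1 h).symm w.2 else 0⟩
  source := Bundle.TotalSpace.proj ⁻¹' e.chart.source
  target := e.chart.source ×ˢ univ
  map_source' z hz := ⟨hz, mem_univ _⟩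
  map_target' w hw := hw.1
  left_inv' := by
    rintro ⟨u, ξ⟩ hz
    have hu : u ∈ e.chart.source := hz
    simp [hu]
  right_inv' := by
    rintro ⟨u, p⟩ hw
    have hu : u ∈ e.chart.source := hw.1
    simp [hu]
  open_target := e.chart.open_source.prod isOpen_univ
  baseSet := e.chart.source
  open_baseSet := e.chart.open_source
  source_eq := rfl
  target_eq := rfl
  proj_toFun _ _ := rfl

theorem pretriv_apply (e : AdaptedChart m n π)
    (L : ∀ u, u ∈ e.chart.source → (Fib u ≃ₗ[ℝ] F₀)) (u : E) (hu : u ∈ e.chart.source)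
    (ξ : Fib u) : pretriv e L ⟨u, ξ⟩ = (u, L u hu ξ) := by
  change (u, _) = _
  simp [hu]

theorem pretriv_symm (e : AdaptedChart m n π)
    (L : ∀ u, u ∈ e.chart.source → (Fib u ≃ₗ[ℝ] F₀)) (u : E) (hu : u ∈ e.chart.source)
    (p : F₀) : (pretriv e L).symm u p = (L u hu).symm p := by
  have h := (pretriv e L).apply_mk_symm (b := u) hu p
  rw [pretriv_apply e L u hu] at h
  rw [LinearEquiv.eq_symm_apply]
  exact congrArg Prod.snd h

variable (m n π) in
/-- An adapted chart around a point. -/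
noncomputable def adaptedChartAt [IsManifold (𝓡 m) ∞ M] [IsSmoothFiberBundle m n π]
    (u : E) : AdaptedChart m n π :=
  Classical.choose (exists_adaptedChart π u)

theorem mem_adaptedChartAt [IsManifold (𝓡 m) ∞ M] [IsSmoothFiberBundle m n π]
    (u : E) : u ∈ (adaptedChartAt m n π u).chart.source :=
  Classical.choose_spec (exists_adaptedChart π u)

theorem exists_smooth_coordChange
    (L : ∀ (e : AdaptedChart m n π) u, u ∈ e.chart.source → (Fib u ≃ₗ[ℝ] F₀))
    (τ : (AdaptedModel m n →L[ℝ] AdaptedModel m n) → (F₀ →L[ℝ] F₀))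
    (hτ : ContDiff ℝ ∞ τ)
    (hL : ∀ (e e' : AdaptedChart m n π) u (hu : u ∈ e.chart.source) (hu' : u ∈ e'.chart.source) p,
      τ (AdaptedChart.jacobian e e' u) p = L e' u hu' ((L e u hu).symm p))
    (e e' : AdaptedChart m n π) :
    ∃ f : E → F₀ →L[ℝ] F₀, ContMDiffOn (𝓡 (m + n)) 𝓘(ℝ, F₀ →L[ℝ] F₀) ∞ f
      ((pretriv e (L e)).baseSet ∩ (pretriv e' (L e')).baseSet) ∧
      ∀ b ∈ (pretriv e (L e)).baseSet ∩ (pretriv e' (L e')).baseSet, ∀ p : F₀,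
        f b p = (pretriv e' (L e') ⟨b, (pretriv e (L e)).symm b p⟩).2 := by
  refine ⟨fun u => τ (AdaptedChart.jacobian e e' u), ?_, ?_⟩
  · exact hτ.contMDiff.comp_contMDiffOn (AdaptedChart.contMDiffOn_jacobian e e')
  · intro u hu p
    rw [pretriv_apply e' (L e') u hu.2, pretriv_symm e (L e) u hu.1]
    exact hL e e' u hu.1 hu.2 p

/-- The vector bundle structure on a family of vector spaces over `E` with coordinates `L` on the
fibres for each adapted chart, which change smoothly. The local trivializations are those of
all adapted charts. -/
@[reducible] noncomputable def adaptedPrebundle [IsManifold (𝓡 m) ∞ M]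
    [IsSmoothFiberBundle m n π] [∀ u, TopologicalSpace (Fib u)]
    (L : ∀ (e : AdaptedChart m n π) u, u ∈ e.chart.source → (Fib u ≃ₗ[ℝ] F₀))
    (τ : (AdaptedModel m n →L[ℝ] AdaptedModel m n) → (F₀ →L[ℝ] F₀))
    (hτ : ContDiff ℝ ∞ τ)
    (hL : ∀ (e e' : AdaptedChart m n π) u (hu : u ∈ e.chart.source) (hu' : u ∈ e'.chart.source) p,
      τ (AdaptedChart.jacobian e e' u) p = L e' u hu' ((L e u hu).symm p))
    (hind : ∀ u, Topology.IsInducing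
      (L (adaptedChartAt m n π u) u (mem_adaptedChartAt u))) :
    VectorPrebundle ℝ F₀ Fib where
  pretrivializationAtlas := range fun e : AdaptedChart m n π => pretriv e (L e)
  pretrivialization_linear' := by
    rintro _ ⟨e, rfl⟩
    refine ⟨fun u hu => ⟨fun ξ ζ => ?_, fun c ξ => ?_⟩⟩ <;>
      simp only [pretriv_apply e (L e) u hu, map_add, map_smul]
  pretrivializationAt u := pretriv (adaptedChartAt m n π u) (L _)
  mem_base_pretrivializationAt u := mem_adaptedChartAt u
  pretrivialization_mem_atlas u := ⟨_, rfl⟩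
  exists_coordChange := by
    rintro _ ⟨e, rfl⟩ _ ⟨e', rfl⟩
    obtain ⟨f, hf, hf'⟩ := exists_smooth_coordChange L τ hτ hL e e'
    exact ⟨f, hf.continuousOn, hf'⟩
  totalSpaceMk_isInducing := by
    intro u
    have h : (pretriv (adaptedChartAt m n π u) (L _) ∘ Bundle.TotalSpace.mk u : Fib u → E × F₀) =
        Prod.mk u ∘ L (adaptedChartAt m n π u) u (mem_adaptedChartAt u) := by
      ext1 ξ
      exact pretriv_apply _ _ u (mem_adaptedChartAt u) ξ
    rw [h]
    exact (isInducing_prodMkRight u).comp (hind u)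

theorem adaptedPrebundle_isContMDiff [IsManifold (𝓡 m) ∞ M]
    [IsSmoothFiberBundle m n π] [∀ u, TopologicalSpace (Fib u)]
    (L : ∀ (e : AdaptedChart m n π) u, u ∈ e.chart.source → (Fib u ≃ₗ[ℝ] F₀))
    (τ : (AdaptedModel m n →L[ℝ] AdaptedModel m n) → (F₀ →L[ℝ] F₀))
    (hτ : ContDiff ℝ ∞ τ)
    (hL : ∀ (e e' : AdaptedChart m n π) u (hu : u ∈ e.chart.source) (hu' : u ∈ e'.chart.source) p,
      τ (AdaptedChart.jacobian e e' u) p = L e' u hu' ((L e u hu).symm p))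
    (hind : ∀ u, Topology.IsInducing
      (L (adaptedChartAt m n π u) u (mem_adaptedChartAt u))) :
    (adaptedPrebundle L τ hτ hL hind).IsContMDiff (𝓡 (m + n)) ∞ where
  exists_contMDiffCoordChange := by
    rintro _ ⟨e, rfl⟩ _ ⟨e', rfl⟩
    exact exists_smooth_coordChange L τ hτ hL e e'

end Prebundle

section DualBundles

variable (m n) (π : E → M)

/-- The fibre over `u` of the extended dual jet bundle `Λᵐ₂(T*E)`. -/
def ExtFiber (u : E) : Type := ExtForm m (vertical m n π u)

/-- The fibre over `u` of `J¹π* = Λᵐ₂(T*E) / Λᵐ₁(T*E)`. -/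
def RedFiber (u : E) : Type := RedForm m (vertical m n π u)

noncomputable instance (u : E) : AddCommGroup (ExtFiber m n π u) :=
  inferInstanceAs (AddCommGroup (ExtForm m (vertical m n π u)))
noncomputable instance (u : E) : Module ℝ (ExtFiber m n π u) :=
  inferInstanceAs (Module ℝ (ExtForm m (vertical m n π u)))
noncomputable instance (u : E) : AddCommGroup (RedFiber m n π u) :=
  inferInstanceAs (AddCommGroup (RedForm m (vertical m n π u)))
noncomputable instance (u : E) : Module ℝ (RedFiber m n π u) :=
  inferInstanceAs (Module ℝ (RedForm m (vertical m n π u)))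

/-- The extended dual jet bundle `Λᵐ₂(T*E)`: pairs of `u : E` and an `m`-form on `T_u E` that vanishes
on any two vertical vectors. -/
abbrev ExtendedDual : Type v := Bundle.TotalSpace (ℝ × (Fin m → Fin n → ℝ)) (ExtFiber m n π)
/-- The reduced dual jet bundle `J¹π* = Λᵐ₂(T*E) / Λᵐ₁(T*E)`. -/
abbrev ReducedDual : Type v := Bundle.TotalSpace (Fin m → Fin n → ℝ) (RedFiber m n π)

variable {m n π}

/-- Fibre coordinates `(p, p i α)` on `Λᵐ₂(T*E)`. -/
noncomputable def extFiberCoord [IsSmoothFiberBundle m n π] (e : AdaptedChart m n π) (u : E)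
    (hu : u ∈ e.chart.source) : ExtFiber m n π u ≃ₗ[ℝ] ℝ × (Fin m → Fin n → ℝ) :=
  extCoordEquiv (e.tangentEquiv u hu) (e.mem_vertical_iff u hu)

/-- Fibre coordinates `p i α` on `J¹π*`. -/
noncomputable def redFiberCoord [IsSmoothFiberBundle m n π] (e : AdaptedChart m n π) (u : E)
    (hu : u ∈ e.chart.source) : RedFiber m n π u ≃ₗ[ℝ] (Fin m → Fin n → ℝ) :=
  redCoordEquiv (e.tangentEquiv u hu) (e.mem_vertical_iff u hu)

variable [IsManifold (𝓡 m) ∞ M] [IsSmoothFiberBundle m n π]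

/-- The usual topology of a finite-dimensional vector space, through a linear isomorphism. -/
noncomputable instance (u : E) : TopologicalSpace (ExtFiber m n π u) :=
  TopologicalSpace.induced (extFiberCoord (adaptedChartAt m n π u) u (mem_adaptedChartAt u))
    inferInstance

noncomputable instance (u : E) : TopologicalSpace (RedFiber m n π u) :=
  TopologicalSpace.induced (redFiberCoord (adaptedChartAt m n π u) u (mem_adaptedChartAt u))
    inferInstance

variable (m n π)

/-- The bundle structure of `Λᵐ₂(T*E)`, with the natural coordinates `(x, u, p, p i α)`. -/
noncomputable def extPrebundle :
    VectorPrebundle ℝ (ℝ × (Fin m → Fin n → ℝ)) (ExtFiber m n π) :=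
  adaptedPrebundle extFiberCoord extTransition contDiff_extTransition
    (fun e e' u hu hu' q => by
      rw [AdaptedChart.jacobian_eq e e' u hu hu']
      exact extTransition_apply _ _ (e.mem_vertical_iff u hu) (e'.mem_vertical_iff u hu') q)
    (fun u => ⟨rfl⟩)

/-- The bundle structure of `J¹π*`, with the natural coordinates `(x, u, p i α)`. -/
noncomputable def redPrebundle :
    VectorPrebundle ℝ (Fin m → Fin n → ℝ) (RedFiber m n π) :=
  adaptedPrebundle redFiberCoord redTransition contDiff_redTransition
    (fun e e' u hu hu' q => by
      rw [AdaptedChart.jacobian_eq e e' u hu hu']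
      exact redTransition_apply _ _ (e.mem_vertical_iff u hu) (e'.mem_vertical_iff u hu') q)
    (fun u => ⟨rfl⟩)

instance : (extPrebundle m n π).IsContMDiff (𝓡 (m + n)) ∞ := by
  unfold extPrebundle; exact adaptedPrebundle_isContMDiff _ _ _ _ _

instance : (redPrebundle m n π).IsContMDiff (𝓡 (m + n)) ∞ := by
  unfold redPrebundle; exact adaptedPrebundle_isContMDiff _ _ _ _ _

noncomputable instance : TopologicalSpace (ExtendedDual m n π) :=
  (extPrebundle m n π).totalSpaceTopology
noncomputable instance : FiberBundle (ℝ × (Fin m → Fin n → ℝ)) (ExtFiber m n π) :=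
  (extPrebundle m n π).toFiberBundle
instance : VectorBundle ℝ (ℝ × (Fin m → Fin n → ℝ)) (ExtFiber m n π) :=
  (extPrebundle m n π).toVectorBundle
instance : ContMDiffVectorBundle ∞ (ℝ × (Fin m → Fin n → ℝ)) (ExtFiber m n π) (𝓡 (m + n)) :=
  (extPrebundle m n π).contMDiffVectorBundle (𝓡 (m + n))

noncomputable instance : TopologicalSpace (ReducedDual m n π) :=
  (redPrebundle m n π).totalSpaceTopology
noncomputable instance : FiberBundle (Fin m → Fin n → ℝ) (RedFiber m n π) :=
  (redPrebundle m n π).toFiberBundle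
instance : VectorBundle ℝ (Fin m → Fin n → ℝ) (RedFiber m n π) :=
  (redPrebundle m n π).toVectorBundle
instance : ContMDiffVectorBundle ∞ (Fin m → Fin n → ℝ) (RedFiber m n π) (𝓡 (m + n)) :=
  (redPrebundle m n π).contMDiffVectorBundle (𝓡 (m + n))

end DualBundles

end FiberBundles

section Manifolds

variable {V : Type*} [NormedAddCommGroup V] [NormedSpace ℝ V] {H : Type*} [TopologicalSpace H]
  (I : ModelWithCorners ℝ V H) {N : Type*} [TopologicalSpace N] [ChartedSpace H N]
  [IsManifold I ∞ N]
  {V' : Type*} [NormedAddCommGroup V'] [NormedSpace ℝ V'] {H' : Type*} [TopologicalSpace H']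
  (I' : ModelWithCorners ℝ V' H') {N' : Type*} [TopologicalSpace N'] [ChartedSpace H' N']
  [IsManifold I' ∞ N']

/-- `X` restricts to a smooth vector field on `U`. -/
def IsSmoothVectorFieldOn (X : ∀ p : N, TangentSpace I p) (U : Set N) : Prop :=
  ContMDiffOn I I.tangent ∞ (fun p => (⟨p, X p⟩ : TangentBundle I N)) U

variable (N) in
/-- A `k`-dimensional (smooth) distribution: a subbundle of rank `k` of the tangent bundle. -/
structure Distribution (k : ℕ) where
  space : ∀ p : N, Submodule ℝ (TangentSpace I p)
  finrank_space : ∀ p, Module.finrank ℝ (space p) = k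
  exists_frame : ∀ p₀ : N, ∃ U : Set N, IsOpen U ∧ p₀ ∈ U ∧
    ∃ Y : Fin k → ∀ p : N, TangentSpace I p, (∀ i, IsSmoothVectorFieldOn I (Y i) U) ∧
      ∀ p ∈ U, space p = Submodule.span ℝ (range fun i => Y i p)

variable {I} in
/-- Through every point there passes a `k`-dimensional integral manifold, here parametrized by an
open set of `ℝᵏ`. (The parametrization is an immersion since the distribution has rank `k`.) -/
def Distribution.IsIntegrable {k : ℕ} (D : Distribution I N k) : Prop :=
  ∀ p₀ : N, ∃ (W : Set (EuclideanSpace ℝ (Fin k))) (f : EuclideanSpace ℝ (Fin k) → N),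
    IsOpen W ∧ 0 ∈ W ∧ ContMDiffOn (𝓡 k) I ∞ f W ∧ f 0 = p₀ ∧
      ∀ y ∈ W, LinearMap.range (mfderiv (𝓡 k) I f y).toLinearMap = D.space (f y)

variable {I} in
/-- `D` is transverse to the fibres of `ρ`. -/
def Distribution.IsTransverse {k : ℕ} (D : Distribution I N k) (ρ : N → N') : Prop :=
  ∀ p : N, IsCompl (D.space p) (LinearMap.ker (mfderiv I I' ρ p).toLinearMap)

/-- `γ` restricts to a smooth local section of `ρ : N → N'` over the open set `U ⊆ N'`. -/
structure IsLocalSection (ρ : N → N') (U : Set N') (γ : N' → N) : Prop where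
  isOpen : IsOpen U
  contMDiffOn : ContMDiffOn I' I ∞ γ U
  right_inv : ∀ x ∈ U, ρ (γ x) = x

variable {I} in
/-- `γ` is a local section of `ρ` and `T_{γ(x)} Im γ = D_{γ(x)}` for all `x ∈ U`; the tangent space
of the image of `γ` at `γ(x)` is the image of `T_x γ`. -/
structure Distribution.IsIntegralSection {k : ℕ} (D : Distribution I N k) (ρ : N → N')
    (U : Set N') (γ : N' → N) : Prop where
  isLocalSection : IsLocalSection I I' ρ U γ
  range_eq : ∀ x ∈ U, LinearMap.range (mfderiv I' I γ x).toLinearMap = D.space (γ x)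

variable (N) in
/-- `k`-vectors at all the points of `N`, a not necessarily smooth section of `Λᵏ(TN)`. -/
abbrev Multivectors (k : ℕ) : Type _ := ∀ p : N, ⋀[ℝ]^k (TangentSpace I p)

variable {I} in
/-- Locally `X = Y₁ ∧ … ∧ Yₖ` with smooth vector fields `Yᵢ`. In particular `X` is smooth. -/
def IsLocallyDecomposable {k : ℕ} (X : Multivectors I N k) : Prop :=
  ∀ p₀ : N, ∃ U : Set N, IsOpen U ∧ p₀ ∈ U ∧
    ∃ Y : Fin k → ∀ p : N, TangentSpace I p, (∀ i, IsSmoothVectorFieldOn I (Y i) U) ∧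
      ∀ p ∈ U, X p = exteriorPower.ιMulti ℝ k fun i => Y i p

variable {I} in
/-- The class `{X}` of multivector fields associated with `D`: the nowhere vanishing, locally
decomposable multivector fields that are sections of `Λᵏ D`. -/
def Distribution.multivectorClass {k : ℕ} (D : Distribution I N k) : Set (Multivectors I N k) :=
  {X | IsLocallyDecomposable X ∧ (∀ p, X p ≠ 0) ∧
    ∀ p, X p ∈ LinearMap.range (exteriorPower.map k (D.space p).subtype)}

variable {I I'} in
/-- The distributions `D` and `D'` are `s`-related: for every `X'` in the class of `D'` there is
an `X` in the class of `D`, and for every `X` in the class of `D` there is an `X'` in the class of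
`D'`, with `X' ∘ s = Λᵏ Ts ∘ X`. -/
def Distribution.IsRelated {k : ℕ} (D : Distribution I N k) (D' : Distribution I' N' k)
    (s : N → N') : Prop :=
  (∀ X' ∈ D'.multivectorClass, ∃ X ∈ D.multivectorClass,
    ∀ p, X' (s p) = exteriorPower.map k (mfderiv I I' s p).toLinearMap (X p)) ∧
  (∀ X ∈ D.multivectorClass, ∃ X' ∈ D'.multivectorClass,
    ∀ p, X' (s p) = exteriorPower.map k (mfderiv I I' s p).toLinearMap (X p))

variable (N) in
/-- `k`-forms at all the points of `N`, a not necessarily smooth differential form. -/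
abbrev Forms (k : ℕ) : Type _ := ∀ p : N, TangentSpace I p [⋀^Fin k]→L[ℝ] ℝ

variable {I} in
/-- Smoothness of a form, tested on smooth local vector fields. -/
def IsSmoothForm {k : ℕ} (θ : Forms I N k) : Prop :=
  ∀ (U : Set N) (Y : Fin k → ∀ p : N, TangentSpace I p), IsOpen U →
    (∀ i, IsSmoothVectorFieldOn I (Y i) U) → ContMDiffOn I 𝓘(ℝ, ℝ) ∞ (fun p => θ p fun i => Y i p) U

variable {I} in
/-- A smooth nowhere vanishing form (of degree `k = dim N`). -/
structure IsVolumeForm {k : ℕ} (θ : Forms I N k) : Prop where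
  smooth : IsSmoothForm θ
  ne_zero : ∀ p, θ p ≠ 0

/-- The pull-back `f^* θ`. -/
noncomputable def pullbackForm {k : ℕ} (f : N → N') (θ : Forms I' N' k) : Forms I N k :=
  fun p => (θ (f p)).compContinuousLinearMap (mfderiv I I' f p)

variable {I} in
/-- The contraction `i(X)θ`. -/
noncomputable def contractForm {k : ℕ} (X : ∀ p : N, TangentSpace I p) (θ : Forms I N (k + 1)) :
    Forms I N k := fun p =>
  { toAlternatingMap := (θ p).toAlternatingMap.curryLeft (X p)
    cont := (θ p).cont.comp (continuous_const.matrixVecCons continuous_id) }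

variable {I} in
/-- The exterior derivative of a form on a manifold, computed in the preferred chart at each point. -/
noncomputable def extDerivForm {k : ℕ} (θ : Forms I N k) : Forms I N (k + 1) := fun p =>
  ContinuousAlternatingMap.compContinuousLinearMap
    (extDeriv (fun y : V => (pullbackForm 𝓘(ℝ, V) I (extChartAt I p).symm θ y :
      V [⋀^Fin k]→L[ℝ] ℝ)) (extChartAt I p p))
    (mfderiv I 𝓘(ℝ, V) (extChartAt I p) p : TangentSpace I p →L[ℝ] V)

end Manifolds

section HamiltonJacobi

variable (m n : ℕ) {M : Type u} {E : Type v}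
  [TopologicalSpace M] [ChartedSpace (EuclideanSpace ℝ (Fin m)) M]
  [TopologicalSpace E] [ChartedSpace (EuclideanSpace ℝ (Fin (m + n))) E] (π : E → M)

/-- The models of the manifolds `Λᵐ₂(T*E)` and `J¹π*`. -/
noncomputable abbrev extModel : ModelWithCorners ℝ
    (EuclideanSpace ℝ (Fin (m + n)) × (ℝ × (Fin m → Fin n → ℝ)))
    (ModelProd (EuclideanSpace ℝ (Fin (m + n))) (ℝ × (Fin m → Fin n → ℝ))) :=
  (𝓡 (m + n)).prod 𝓘(ℝ, ℝ × (Fin m → Fin n → ℝ))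

noncomputable abbrev redModel : ModelWithCorners ℝ
    (EuclideanSpace ℝ (Fin (m + n)) × (Fin m → Fin n → ℝ))
    (ModelProd (EuclideanSpace ℝ (Fin (m + n))) (Fin m → Fin n → ℝ)) :=
  (𝓡 (m + n)).prod 𝓘(ℝ, Fin m → Fin n → ℝ)

variable {m n π} in
/-- The quotient map `μ : Λᵐ₂(T*E) → J¹π*`. -/
noncomputable def dualQuotient (z : ExtendedDual m n π) : ReducedDual m n π := ⟨z.1, RedForm.mk z.2⟩

variable {m n π} in
/-- The `m`-form on `T_u E` that an element of `Λᵐ₂(T_u^*E)` is. -/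
def ExtFiber.form {u : E} (ξ : ExtFiber m n π u) : TangentSpace (𝓡 (m + n)) u [⋀^Fin m]→L[ℝ] ℝ :=
  Subtype.val (show semibasic₂ m (vertical m n π u) from ξ)

variable [IsManifold (𝓡 m) ∞ M] [IsManifold (𝓡 (m + n)) ∞ E] [IsSmoothFiberBundle m n π]

/-- The tautological form `Θ`. -/
noncomputable def liouvilleForm : Forms (extModel m n) (ExtendedDual m n π) m := fun z =>
  z.2.form.compContinuousLinearMap
    (mfderiv (extModel m n) (𝓡 (m + n)) (Bundle.TotalSpace.proj : ExtendedDual m n π → E) z)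

/-- The canonical multisymplectic form `Ω = -dΘ`. -/
noncomputable def canonicalForm : Forms (extModel m n) (ExtendedDual m n π) (m + 1) :=
  fun z => -extDerivForm (liouvilleForm m n π) z

variable {π}

/-- `h` is a Hamiltonian section: a global section of `μ`. -/
structure IsHamiltonianSection (h : ReducedDual m n π → ExtendedDual m n π) : Prop where
  contMDiff : ContMDiff (redModel m n) (extModel m n) ∞ h
  right_inv : ∀ z, dualQuotient (h z) = z

/-- The Hamilton-Cartan form `Ω_h = h^* Ω`. -/
noncomputable def hamiltonCartanForm (h : ReducedDual m n π → ExtendedDual m n π) :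
    Forms (redModel m n) (ReducedDual m n π) (m + 1) :=
  pullbackForm (redModel m n) (extModel m n) h (canonicalForm m n π)

/-- The field equation `ψ^* i(X)Ω_h = 0` on `U`, for every vector field `X` on `J¹π*`. -/
def SolvesFieldEquation (h : ReducedDual m n π → ExtendedDual m n π) (U : Set M)
    (ψ : M → ReducedDual m n π) : Prop :=
  ∀ X : ∀ z : ReducedDual m n π, TangentSpace (redModel m n) z,
    IsSmoothVectorFieldOn (redModel m n) X univ →
      ∀ x ∈ U, pullbackForm (𝓡 m) (redModel m n) ψ
        (contractForm X (hamiltonCartanForm m n h)) x = 0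

variable (π) in
/-- The projection `J¹π* → M`. -/
def redProj (z : ReducedDual m n π) : M := π z.proj

/-- `Dh` solves the Hamiltonian problem: it is transverse to `J¹π* → M` and integrable, and its
integral sections solve the field equation. -/
structure SolvesHamiltonianProblem (h : ReducedDual m n π → ExtendedDual m n π)
    (Dh : Distribution (redModel m n) (ReducedDual m n π) m) : Prop where
  isTransverse : Dh.IsTransverse (𝓡 m) (redProj m n π)
  isIntegrable : Dh.IsIntegrable
  solves : ∀ (U : Set M) (ψ : M → ReducedDual m n π),
    Dh.IsIntegralSection (𝓡 m) (redProj m n π) U ψ → SolvesFieldEquation m n h U ψ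

/-- The generalized Hamiltonian Hamilton-Jacobi condition: if `γ` is an integral section of `D`,
then `s ∘ γ` is an integral section of `Dh`. -/
def GeneralizedHJCondition (Dh : Distribution (redModel m n) (ReducedDual m n π) m)
    (s : E → ReducedDual m n π) (D : Distribution (𝓡 (m + n)) E m) : Prop :=
  ∀ (U : Set M) (γ : M → E), D.IsIntegralSection (𝓡 m) π U γ →
    Dh.IsIntegralSection (𝓡 m) (redProj m n π) U (s ∘ γ)

end HamiltonJacobi

end HJ

open HJ

/-!
Both conditions say that `T_p s (D_p) = (D_h)_{s(p)}` at every point `p`.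

For the first one: an integral manifold of a distribution transverse to the fibres projects
diffeomorphically to the base near each of its points, so an integral section of `D` passes through
every `p`, and the tangent space of the image of `s ∘ γ` is the image under `Ts` of that of `γ`.

For the second one: a nonzero `k`-vector lies in `Λᵏ W` for at most one `k`-dimensional `W`, so a
single pair of related multivector fields determines `T_p s (D_p)`. Such a pair exists because the
volume form provides a nowhere vanishing `k`-vector field on the base, which lifts horizontally to
`D`. Conversely, if `T_p s (D_p) = (D_h)_{s(p)}`, the tangent map of the projection is a left
inverse of `Ts` and carries multivector fields of `D_h` down to `D`, while horizontal lifting to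
`D_h` extends the multivector fields of `D` off the image of `s`.
-/

namespace HJ

section LinearAlgebra

section CommRing

variable {R T T' T'' : Type*} [CommRing R] [AddCommGroup T] [Module R T] [AddCommGroup T']
  [Module R T'] [AddCommGroup T''] [Module R T''] {k : ℕ}

theorem exteriorPower_map_map (g : T' →ₗ[R] T'') (f : T →ₗ[R] T') (w : ⋀[R]^k T) :
    exteriorPower.map k g (exteriorPower.map k f w) = exteriorPower.map k (g ∘ₗ f) w := by
  rw [exteriorPower.map_comp, LinearMap.comp_apply]

/-- The image of `Λᵏ W` in `Λᵏ T`, for a submodule `W` of `T`. -/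
noncomputable abbrev exteriorSubmodule (k : ℕ) (W : Submodule R T) : Submodule R (⋀[R]^k T) :=
  LinearMap.range (exteriorPower.map k W.subtype)

theorem map_exteriorSubmodule (f : T →ₗ[R] T') (W : Submodule R T) :
    (exteriorSubmodule k W).map (exteriorPower.map k f) = exteriorSubmodule k (W.map f) := by
  have hfW : f ∘ₗ W.subtype = (W.map f).subtype ∘ₗ f.submoduleMap W := rfl
  rw [exteriorSubmodule, exteriorSubmodule, ← LinearMap.range_comp, ← exteriorPower.map_comp, hfW,
    exteriorPower.map_comp, LinearMap.range_comp_of_range_eq_top _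
      (LinearMap.range_eq_top.2 (exteriorPower.map_surjective (f.submoduleMap_surjective W)))]

theorem exteriorPower_map_mem_exteriorSubmodule {f : T →ₗ[R] T'} {W : Submodule R T'}
    (hf : LinearMap.range f ≤ W) (w : ⋀[R]^k T) :
    exteriorPower.map k f w ∈ exteriorSubmodule k W :=
  ⟨exteriorPower.map k (f.codRestrict W fun v => hf ⟨v, rfl⟩) w, by
    rw [exteriorPower_map_map, LinearMap.subtype_comp_codRestrict]⟩

theorem exteriorPower_map_apply_eq_self {f : T →ₗ[R] T} {W : Submodule R T}
    (hf : ∀ v ∈ W, f v = v) {w : ⋀[R]^k T} (hw : w ∈ exteriorSubmodule k W) :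
    exteriorPower.map k f w = w := by
  obtain ⟨a, rfl⟩ := hw
  rw [exteriorPower_map_map]
  congr 2
  exact LinearMap.ext fun v => hf v v.2

end CommRing

section Field

variable {K T T' : Type*} [Field K] [AddCommGroup T] [Module K T] [AddCommGroup T'] [Module K T']
  {k : ℕ}

theorem exteriorPower_map_injOn {f : T →ₗ[K] T'} {W : Submodule K T} (hf : Set.InjOn f W) :
    Set.InjOn (exteriorPower.map k f) (exteriorSubmodule k W) := by
  rintro _ ⟨a, rfl⟩ _ ⟨b, rfl⟩ hab
  rw [exteriorPower_map_map, exteriorPower_map_map] at hab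
  have hfW : Function.Injective (f ∘ₗ W.subtype) := Set.injOn_iff_injective.1 hf
  rw [exteriorPower.map_injective_field hfW hab]

theorem exteriorPower_map_eq_zero_of_finrank_range_lt [FiniteDimensional K T] {f : T →ₗ[K] T'}
    (hf : Module.finrank K (LinearMap.range f) < k) : exteriorPower.map k f = 0 := by
  refine exteriorPower.linearMap_ext (AlternatingMap.ext fun a => ?_)
  rw [LinearMap.compAlternatingMap_apply, exteriorPower.map_apply_ιMulti]
  refine AlternatingMap.map_linearDependent (exteriorPower.ιMulti K k) _ fun hli => ?_
  have hli' : LinearIndependent K (f.rangeRestrict ∘ a) :=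
    LinearIndependent.of_comp (LinearMap.range f).subtype hli
  have hle := hli'.fintype_card_le_finrank
  rw [Fintype.card_fin] at hle
  exact hf.not_ge hle

theorem le_of_mem_exteriorSubmodule {W W' : Submodule K T} [FiniteDimensional K W]
    (hW : Module.finrank K W ≤ k) {w : ⋀[K]^k T} (hw : w ≠ 0) (h : w ∈ exteriorSubmodule k W)
    (h' : w ∈ exteriorSubmodule k W') : W ≤ W' := by
  intro v hv
  by_contra hv'
  obtain ⟨φ, hφv, hφ⟩ := W'.exists_le_ker_of_notMem hv'
  -- `f` fixes `W'`, hence `w`; it kills `v ∈ W`, hence all of `Λᵏ W`.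
  let f : T →ₗ[K] T := LinearMap.id - φ.smulRight ((φ v)⁻¹ • v)
  have hf_fix : ∀ x ∈ W', f x = x := fun x hx => by
    simp [f, show φ x = 0 from hφ hx]
  have hfv : f v = 0 := by simp [f, smul_smul, hφv]
  have hker : LinearMap.ker (f ∘ₗ W.subtype) ≠ ⊥ := fun hbot => hv' <| by
    have hv0 : (⟨v, hv⟩ : W) ∈ LinearMap.ker (f ∘ₗ W.subtype) := hfv
    rw [hbot, Submodule.mem_bot] at hv0
    rw [show v = 0 from congrArg Subtype.val hv0]
    exact W'.zero_mem
  have hrange : Module.finrank K (LinearMap.range (f ∘ₗ W.subtype)) < k := by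
    have hsum := (f ∘ₗ W.subtype).finrank_range_add_finrank_ker
    have hpos := Submodule.one_le_finrank_iff.2 hker
    omega
  obtain ⟨a, rfl⟩ := h
  apply hw
  rw [← exteriorPower_map_apply_eq_self hf_fix h', exteriorPower_map_map,
    exteriorPower_map_eq_zero_of_finrank_range_lt hrange, LinearMap.zero_apply]

theorem alternatingMapLinearEquiv_bijective [FiniteDimensional K T] {η : T [⋀^Fin k]→ₗ[K] K}
    (hT : Module.finrank K T = k) (hη : η ≠ 0) :
    Function.Bijective (exteriorPower.alternatingMapLinearEquiv η) := by
  have hsurj : Function.Surjective (exteriorPower.alternatingMapLinearEquiv η) :=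
    LinearMap.surjective ((map_ne_zero_iff _ (LinearEquiv.injective _)).2 hη)
  refine ⟨(LinearMap.injective_iff_surjective_of_finrank_eq_finrank ?_).2 hsurj, hsurj⟩
  rw [exteriorPower.finrank_eq, hT, Nat.choose_self, Module.finrank_self]

end Field

end LinearAlgebra

section SmoothCoefficients

variable {𝕜 : Type*} [NontriviallyNormedField 𝕜] [CompleteSpace 𝕜]
  {V : Type*} [NormedAddCommGroup V] [NormedSpace 𝕜 V] {H : Type*} [TopologicalSpace H]
  {I : ModelWithCorners 𝕜 V H} {N : Type*} [TopologicalSpace N] [ChartedSpace H N]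
  {F : Type*} [NormedAddCommGroup F] [NormedSpace 𝕜 F] [FiniteDimensional 𝕜 F]
  {ι : Type*} [Fintype ι] {r : WithTop ℕ∞} {p₀ : N}

theorem exists_contMDiffAt_sum_smul_eq {v : ι → N → F} {b : N → F}
    (hv : ∀ i, ContMDiffAt I 𝓘(𝕜, F) r (v i) p₀)
    (hspan : Submodule.span 𝕜 (range fun i => v i p₀) = ⊤) (hb : ContMDiffAt I 𝓘(𝕜, F) r b p₀) :
    ∃ c : ι → N → 𝕜, (∀ i, ContMDiffAt I 𝓘(𝕜, 𝕜) r (c i) p₀) ∧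
      ∀ᶠ p in 𝓝 p₀, ∑ i, c i p • v i p = b p := by
  let B : N → (ι → 𝕜) →L[𝕜] F := fun p =>
    ∑ i, ContinuousLinearMap.smulRightL 𝕜 (ι → 𝕜) F (ContinuousLinearMap.proj i) (v i p)
  have hB_apply : ∀ p a, B p a = ∑ i, a i • v i p := fun p a => by simp [B]
  have hB : ContMDiffAt I 𝓘(𝕜, (ι → 𝕜) →L[𝕜] F) r B p₀ := contMDiffAt_finsetSum fun i _ =>
    (ContinuousLinearMap.contDiff _).contMDiff.contMDiffAt.comp p₀ (hv i)
  have hB_surj : LinearMap.range (B p₀).toLinearMap = ⊤ := by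
    refine top_le_iff.1 (hspan.symm.le.trans fun w hw => ?_)
    obtain ⟨a, ha⟩ := (Submodule.mem_span_range_iff_exists_fun 𝕜).1 hw
    exact ⟨a, (hB_apply p₀ a).trans ha⟩
  obtain ⟨S, hS⟩ := (B p₀).exists_rightInverse_of_surjective hB_surj
  let A : N → F →L[𝕜] F := fun p => (B p).comp S
  have hA : ContMDiffAt I 𝓘(𝕜, F →L[𝕜] F) r A p₀ := hB.clm_comp contMDiffAt_const
  have hA₀ : A p₀ = (ContinuousLinearEquiv.refl 𝕜 F : F →L[𝕜] F) := hS
  have : CompleteSpace F := FiniteDimensional.complete 𝕜 F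
  have hA_inv : ContDiffAt 𝕜 r ContinuousLinearMap.inverse (A p₀) :=
    hA₀ ▸ contDiffAt_map_inverse (ContinuousLinearEquiv.refl 𝕜 F)
  have hc : ContMDiffAt I 𝓘(𝕜, ι → 𝕜) r (fun p => S ((A p).inverse (b p))) p₀ :=
    contMDiffAt_const.clm_apply ((hA_inv.contMDiffAt.comp p₀ hA).clm_apply hb)
  refine ⟨fun i p => S ((A p).inverse (b p)) i, fun i => contMDiffAt_pi_space.1 hc i, ?_⟩
  filter_upwards [hA.continuousAt.eventually_mem
    (hA₀ ▸ (ContinuousLinearEquiv.refl 𝕜 F).nhds)] with p ⟨e, he⟩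
  rw [← hB_apply]
  change A p ((A p).inverse (b p)) = b p
  rw [← he, ContinuousLinearMap.inverse_equiv]
  exact e.apply_symm_apply _

variable {V' : Type*} [NormedAddCommGroup V'] [NormedSpace 𝕜 V'] {H' : Type*}
  [TopologicalSpace H'] {I' : ModelWithCorners 𝕜 V' H'} {N' : Type*} [TopologicalSpace N']
  [ChartedSpace H' N'] {E : N' → Type*} [∀ x, AddCommGroup (E x)] [∀ x, Module 𝕜 (E x)]
  [∀ x, TopologicalSpace (E x)] [TopologicalSpace (Bundle.TotalSpace F E)] [FiberBundle F E]
  [VectorBundle 𝕜 F E]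

theorem exists_contMDiffAt_sum_smul_section_eq {ρ : N → N'} {v : ι → ∀ p, E (ρ p)}
    {b : ∀ p, E (ρ p)}
    (hv : ∀ i, ContMDiffAt I (I'.prod 𝓘(𝕜, F)) r
      (fun p => (⟨ρ p, v i p⟩ : Bundle.TotalSpace F E)) p₀)
    (hspan : Submodule.span 𝕜 (range fun i => v i p₀) = ⊤)
    (hb : ContMDiffAt I (I'.prod 𝓘(𝕜, F)) r
      (fun p => (⟨ρ p, b p⟩ : Bundle.TotalSpace F E)) p₀) :
    ∃ c : ι → N → 𝕜, (∀ i, ContMDiffAt I 𝓘(𝕜, 𝕜) r (c i) p₀) ∧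
      ∀ᶠ p in 𝓝 p₀, ∑ i, c i p • v i p = b p := by
  let e := trivializationAt F E (ρ p₀)
  obtain ⟨hρ, hb'⟩ := Bundle.contMDiffAt_totalSpace.1 hb
  have he_nhds : e.baseSet ∈ 𝓝 (ρ p₀) :=
    e.open_baseSet.mem_nhds (FiberBundle.mem_baseSet_trivializationAt F E (ρ p₀))
  have hspan' : Submodule.span 𝕜 (range fun i => (e ⟨ρ p₀, v i p₀⟩).2) = ⊤ := by
    let e₀ := e.continuousLinearEquivAt 𝕜 (ρ p₀) (mem_of_mem_nhds he_nhds)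
    change Submodule.span 𝕜 (range (e₀.toLinearMap ∘ fun i => v i p₀)) = ⊤
    rw [range_comp, ← Submodule.map_span, hspan, Submodule.map_top]
    exact LinearMap.range_eq_top.2 e₀.surjective
  obtain ⟨c, hc, hcb⟩ := exists_contMDiffAt_sum_smul_eq
    (fun i => (Bundle.contMDiffAt_totalSpace.1 (hv i)).2) hspan' hb'
  refine ⟨c, hc, ?_⟩
  filter_upwards [hcb, hρ.continuousAt.preimage_mem_nhds he_nhds] with p hp hpe
  let eₚ := e.continuousLinearEquivAt 𝕜 (ρ p) hpe
  apply eₚ.injective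
  rw [map_sum]
  simp only [map_smul]
  exact hp

end SmoothCoefficients

section HorizontalLift

variable {V : Type*} [NormedAddCommGroup V] [NormedSpace ℝ V] {H : Type*} [TopologicalSpace H]
  {I : ModelWithCorners ℝ V H} {N : Type*} [TopologicalSpace N] [ChartedSpace H N]
  [IsManifold I ∞ N]
  {V' : Type*} [NormedAddCommGroup V'] [NormedSpace ℝ V'] {H' : Type*} [TopologicalSpace H']
  {I' : ModelWithCorners ℝ V' H'} {N' : Type*} [TopologicalSpace N'] [ChartedSpace H' N']
  {k : ℕ} {ρ : N → N'}

namespace Distribution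

instance finiteDimensional_space (D : Distribution I N k) (p : N) :
    FiniteDimensional ℝ (D.space p) := by
  obtain ⟨U, -, hp, Y, -, hspan⟩ := D.exists_frame p
  rw [hspan p hp]
  exact FiniteDimensional.span_of_finite ℝ (finite_range _)

theorem IsTransverse.injOn_mfderiv {D : Distribution I N k} (hD : D.IsTransverse I' ρ) (p : N) :
    Set.InjOn (mfderiv I I' ρ p).toLinearMap (D.space p) :=
  LinearMap.injOn_of_disjoint_ker le_rfl (hD p).disjoint

variable [FiniteDimensional ℝ V']

/-- The isomorphism `D_p ≃ T_{ρ p} N'` induced by `Tρ` on a distribution transverse to `ρ`. -/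
noncomputable def spaceEquiv (D : Distribution I N k) (hD : D.IsTransverse I' ρ)
    (hk : Module.finrank ℝ V' = k) (p : N) : D.space p ≃ₗ[ℝ] TangentSpace I' (ρ p) :=
  haveI : FiniteDimensional ℝ (TangentSpace I' (ρ p)) := inferInstanceAs (FiniteDimensional ℝ V')
  LinearEquiv.ofInjectiveOfFinrankEq ((mfderiv I I' ρ p).toLinearMap ∘ₗ (D.space p).subtype)
    (Set.injOn_iff_injective.1 (hD.injOn_mfderiv p)) ((D.finrank_space p).trans hk.symm)

variable (D : Distribution I N k) (hD : D.IsTransverse I' ρ) (hk : Module.finrank ℝ V' = k)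

/-- The horizontal lift of tangent vectors of the base to a distribution `D` transverse to `ρ`,
with values in `T_p N` rather than `D_p` so that smoothness of a lift can be expressed. -/
noncomputable def lift (p : N) : TangentSpace I' (ρ p) →ₗ[ℝ] TangentSpace I p :=
  (D.space p).subtype ∘ₗ (D.spaceEquiv hD hk p).symm.toLinearMap

theorem lift_mem (p : N) (v : TangentSpace I' (ρ p)) : D.lift hD hk p v ∈ D.space p :=
  Subtype.property _

theorem mfderiv_lift (p : N) (v : TangentSpace I' (ρ p)) :
    mfderiv I I' ρ p (D.lift hD hk p v) = v :=
  (D.spaceEquiv hD hk p).apply_symm_apply v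

theorem lift_mfderiv {p : N} {w : TangentSpace I p} (hw : w ∈ D.space p) :
    D.lift hD hk p (mfderiv I I' ρ p w) = w :=
  hD.injOn_mfderiv p (D.lift_mem hD hk p _) hw (D.mfderiv_lift hD hk p _)

theorem lift_injective (p : N) : Function.Injective (D.lift hD hk p) :=
  Function.LeftInverse.injective (D.mfderiv_lift hD hk p)

theorem contMDiffAt_lift [IsManifold I' ∞ N'] (hρ : ContMDiff I I' ∞ ρ)
    {X : ∀ p : N, TangentSpace I' (ρ p)} {p₀ : N}
    (hX : ContMDiffAt I I'.tangent ∞ (fun p => (⟨ρ p, X p⟩ : TangentBundle I' N')) p₀) :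
    ContMDiffAt I I.tangent ∞
      (fun p => (⟨p, D.lift hD hk p (X p)⟩ : TangentBundle I N)) p₀ := by
  obtain ⟨U, hU, hp₀, Y, hY, hspan⟩ := D.exists_frame p₀
  have hU₀ := hU.mem_nhds hp₀
  have hρY : ∀ i, ContMDiffAt I I'.tangent ∞
      (fun p => (⟨ρ p, mfderiv I I' ρ p (Y i p)⟩ : TangentBundle I' N')) p₀ := fun i =>
    ((hρ.contMDiff_tangentMap (m := ∞) le_rfl).contMDiffAt).comp p₀ ((hY i).contMDiffAt hU₀)
  have hρY_span : Submodule.span ℝ (range fun i => mfderiv I I' ρ p₀ (Y i p₀)) = ⊤ := by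
    refine top_le_iff.1 fun v _ => ?_
    have hv := Submodule.mem_map_of_mem (f := (mfderiv I I' ρ p₀).toLinearMap)
      (D.lift_mem hD hk p₀ v)
    rw [hspan p₀ hp₀, Submodule.map_span, ← range_comp] at hv
    exact D.mfderiv_lift hD hk p₀ v ▸ hv
  obtain ⟨c, hc, hcX⟩ := exists_contMDiffAt_sum_smul_section_eq hρY hρY_span hX
  have hsum : ContMDiffAt I I.tangent ∞
      (fun p => (⟨p, ∑ i, c i p • Y i p⟩ : TangentBundle I N)) p₀ :=
    ContMDiffAt.sum_section fun i _ => (hc i).smul_section ((hY i).contMDiffAt hU₀)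
  refine hsum.congr_of_eventuallyEq ?_
  filter_upwards [hcX, hU₀] with p hp hpU
  have hmem : ∑ i, c i p • Y i p ∈ D.space p := by
    rw [hspan p hpU]
    exact (Submodule.mem_span_range_iff_exists_fun ℝ).2 ⟨fun i => c i p, rfl⟩
  rw [← D.lift_mfderiv hD hk hmem, map_sum]
  simp only [map_smul]
  rw [hp]

end Distribution

end HorizontalLift

section InverseFunctionTheorem

variable {𝕂 : Type*} [RCLike 𝕂] {F : Type*} [NormedAddCommGroup F] [NormedSpace 𝕂 F]
  [CompleteSpace F] {G : Type*} [NormedAddCommGroup G] [NormedSpace 𝕂 G]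
  {r : WithTop ℕ∞} {W : Set F} {y : F}

theorem exists_openPartialHomeomorph_of_isInvertible_fderiv {f : F → G} (hr : r ≠ 0)
    (hW : IsOpen W) (hf : ContDiffOn 𝕂 r f W) (hy : y ∈ W) (hinv : (fderiv 𝕂 f y).IsInvertible) :
    ∃ R : OpenPartialHomeomorph F G, ⇑R = f ∧ y ∈ R.source ∧ R.source ⊆ W ∧
      ContDiffOn 𝕂 r R.symm R.target := by
  have hf_at : ∀ z ∈ W, ContDiffAt 𝕂 r f z := fun z hz => hf.contDiffAt (hW.mem_nhds hz)
  have hf_deriv : ∀ z ∈ W, HasFDerivAt f (fderiv 𝕂 f z) z := fun z hz =>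
    ((hf_at z hz).differentiableAt hr).hasFDerivAt
  have hinv_nhds : ∀ᶠ z in 𝓝 y, (fderiv 𝕂 f z).IsInvertible := by
    obtain ⟨e, he⟩ := hinv
    have hcont : ContDiffAt 𝕂 0 (fderiv 𝕂 f) y :=
      (hf_at y hy).fderiv_right (by simpa using ENat.one_le_iff_ne_zero_withTop.2 hr)
    exact hcont.continuousAt.eventually_mem (he ▸ e.nhds)
  obtain ⟨S, hS, hS_open, hyS⟩ := mem_nhds_iff.1 (hinv_nhds.and (hW.mem_nhds hy))
  obtain ⟨e, he⟩ := hinv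
  let R := ((hf_at y hy).toOpenPartialHomeomorph f (he ▸ hf_deriv y hy) hr).restrOpen S hS_open
  have hRS : R.source ⊆ S := inter_subset_right
  refine ⟨R, rfl, ⟨(hf_at y hy).mem_toOpenPartialHomeomorph_source _ hr, hyS⟩,
    fun z hz => (hS (hRS hz)).2, fun x hx => ContDiffAt.contDiffWithinAt ?_⟩
  obtain ⟨⟨e', he'⟩, hxW⟩ := hS (hRS (R.map_target hx))
  exact R.contDiffAt_symm hx (he' ▸ hf_deriv _ hxW) (hf_at _ hxW)

theorem exists_contMDiffOn_right_inverse_of_isInvertible_mfderiv {H : Type*} [TopologicalSpace H]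
    {I : ModelWithCorners 𝕂 G H} {N : Type*} [TopologicalSpace N] [ChartedSpace H N]
    [IsManifold I r N] {g : F → N} (hr : r ≠ 0) (hW : IsOpen W)
    (hg : ContMDiffOn 𝓘(𝕂, F) I r g W) (hy : y ∈ W)
    (hinv : (mfderiv 𝓘(𝕂, F) I g y).IsInvertible) :
    ∃ (U : Set N) (σ : N → F), IsOpen U ∧ g y ∈ U ∧ ContMDiffOn I 𝓘(𝕂, F) r σ U ∧
      MapsTo σ U W ∧ (∀ x ∈ U, g (σ x) = x) ∧ σ (g y) = y := by
  have : IsManifold I 1 N := .of_le (ENat.one_le_iff_ne_zero_withTop.2 hr)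
  let φ := extChartAt I (g y)
  have hφ_open : IsOpen φ.source := isOpen_extChartAt_source (g y)
  have hgy : g y ∈ φ.source := mem_extChartAt_source (g y)
  have hφ : ContMDiffOn I 𝓘(𝕂, G) r φ φ.source := by
    rw [extChartAt_source]
    exact contMDiffOn_extChartAt
  have hS_open : IsOpen (W ∩ g ⁻¹' φ.source) := hg.continuousOn.isOpen_inter_preimage hW hφ_open
  have hφg : ContDiffOn 𝕂 r (φ ∘ g) (W ∩ g ⁻¹' φ.source) :=
    (hφ.comp (hg.mono inter_subset_left) fun z hz => hz.2).contDiffOn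
  have hφg_inv : (fderiv 𝕂 (φ ∘ g) y).IsInvertible := by
    rw [← mfderiv_eq_fderiv, mfderiv_comp y
      ((hφ.contMDiffAt (hφ_open.mem_nhds hgy)).mdifferentiableAt hr)
      ((hg.contMDiffAt (hW.mem_nhds hy)).mdifferentiableAt hr)]
    exact (isInvertible_mfderiv_extChartAt hgy).comp hinv
  obtain ⟨R, hR, hyR, hRS, hR_symm⟩ :=
    exists_openPartialHomeomorph_of_isInvertible_fderiv hr hS_open hφg ⟨hy, hgy⟩ hφg_inv
  have hRy : R y = φ (g y) := congrFun hR y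
  refine ⟨φ.source ∩ φ ⁻¹' R.target, R.symm ∘ φ,
    hφ.continuousOn.isOpen_inter_preimage hφ_open R.open_target,
    ⟨hgy, by rw [mem_preimage, ← hRy]; exact R.map_source hyR⟩,
    hR_symm.contMDiffOn.comp (hφ.mono inter_subset_left) fun x hx => hx.2,
    fun x hx => (hRS (R.map_target hx.2)).1, fun x hx => ?_, ?_⟩
  · have hφx : φ (g (R.symm (φ x))) = φ x := (congrFun hR _).symm.trans (R.right_inv hx.2)
    exact φ.injOn (hRS (R.map_target hx.2)).2 hx.1 hφx
  · rw [Function.comp_apply, ← hRy, R.left_inv hyR]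

end InverseFunctionTheorem

theorem isInvertible_of_surjective_of_finrank_eq {𝕜 F G : Type*} [NontriviallyNormedField 𝕜]
    [CompleteSpace 𝕜] [NormedAddCommGroup F] [NormedSpace 𝕜 F] [FiniteDimensional 𝕜 F]
    [NormedAddCommGroup G] [NormedSpace 𝕜 G] [FiniteDimensional 𝕜 G] {A : F →L[𝕜] G}
    (hA : Function.Surjective A) (hd : Module.finrank 𝕜 F = Module.finrank 𝕜 G) :
    A.IsInvertible :=
  have hA_inj : Function.Injective A.toLinearMap :=
    (LinearMap.injective_iff_surjective_of_finrank_eq_finrank hd).2 hA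
  ⟨(LinearEquiv.ofBijective A.toLinearMap ⟨hA_inj, hA⟩).toContinuousLinearEquiv, rfl⟩

section IntegralSections

variable {V : Type*} [NormedAddCommGroup V] [NormedSpace ℝ V] {H : Type*} [TopologicalSpace H]
  {I : ModelWithCorners ℝ V H} {N : Type*} [TopologicalSpace N] [ChartedSpace H N]
  {V' : Type*} [NormedAddCommGroup V'] [NormedSpace ℝ V'] {H' : Type*} [TopologicalSpace H']
  {I' : ModelWithCorners ℝ V' H'} {N' : Type*} [TopologicalSpace N'] [ChartedSpace H' N']
  {V₁ : Type*} [NormedAddCommGroup V₁] [NormedSpace ℝ V₁] {H₁ : Type*} [TopologicalSpace H₁]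
  {I₁ : ModelWithCorners ℝ V₁ H₁} {N₁ : Type*} [TopologicalSpace N₁] [ChartedSpace H₁ N₁]
  {k : ℕ} {ρ : N → N'} {ρ₁ : N₁ → N'} {s : N → N₁} {U : Set N'} {γ : N' → N} {x : N'}

theorem IsLocalSection.hasMFDerivAt (h : IsLocalSection I I' ρ U γ) (hx : x ∈ U) :
    HasMFDerivAt I' I γ x (mfderiv I' I γ x) :=
  ((h.contMDiffOn.contMDiffAt (h.isOpen.mem_nhds hx)).mdifferentiableAt (by simp)).hasMFDerivAt

theorem IsLocalSection.mfderiv_mfderiv_apply (hρ : ContMDiff I I' ∞ ρ)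
    (h : IsLocalSection I I' ρ U γ) (hx : x ∈ U) (v : TangentSpace I' x) :
    (mfderiv I I' ρ (γ x) (mfderiv I' I γ x v) : V') = v := by
  have hcomp := (hρ.mdifferentiable (by simp) (γ x)).hasMFDerivAt.comp x (h.hasMFDerivAt hx)
  have hid : HasMFDerivAt I' I' (ρ ∘ γ) x (ContinuousLinearMap.id ℝ (TangentSpace I' x)) :=
    (hasMFDerivAt_id x).congr_of_eventuallyEq <| by
      filter_upwards [h.isOpen.mem_nhds hx] with z hz using h.right_inv z hz
  exact DFunLike.congr_fun (hasMFDerivAt_unique hcomp hid) v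

variable [IsManifold I ∞ N] {D : Distribution I N k}

theorem IsLocalSection.isIntegralSection (hρ : ContMDiff I I' ∞ ρ)
    (hk : Module.finrank ℝ V' = k) (h : IsLocalSection I I' ρ U γ)
    (hle : ∀ x ∈ U, LinearMap.range (mfderiv I' I γ x).toLinearMap ≤ D.space (γ x)) :
    D.IsIntegralSection I' ρ U γ where
  isLocalSection := h
  range_eq x hx := by
    have hinj : Function.Injective (mfderiv I' I γ x).toLinearMap := fun v w hvw =>
      (h.mfderiv_mfderiv_apply hρ hx v).symm.trans
        ((congrArg (mfderiv I I' ρ (γ x)) hvw).trans (h.mfderiv_mfderiv_apply hρ hx w))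
    refine Submodule.eq_of_le_of_finrank_eq (hle x hx) ?_
    rw [D.finrank_space, LinearMap.finrank_range_of_inj hinj]
    exact hk

theorem Distribution.IsIntegralSection.range_mfderiv_comp (hs : ContMDiff I I₁ ∞ s)
    (h : D.IsIntegralSection I' ρ U γ) (hx : x ∈ U) :
    LinearMap.range (mfderiv I' I₁ (s ∘ γ) x).toLinearMap =
      (D.space (γ x)).map (mfderiv I I₁ s (γ x)).toLinearMap := by
  have hcomp := (hs.mdifferentiable (by simp) (γ x)).hasMFDerivAt.comp x
    (h.isLocalSection.hasMFDerivAt hx)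
  rw [hcomp.mfderiv, ← h.range_eq x hx]
  exact LinearMap.range_comp _ _

variable [FiniteDimensional ℝ V'] [IsManifold I' ∞ N']

theorem Distribution.IsIntegrable.exists_isIntegralSection (hD : D.IsIntegrable)
    (hDt : D.IsTransverse I' ρ) (hρ : ContMDiff I I' ∞ ρ) (hk : Module.finrank ℝ V' = k) (p₀ : N) :
    ∃ (U : Set N') (γ : N' → N), D.IsIntegralSection I' ρ U γ ∧ ρ p₀ ∈ U ∧ γ (ρ p₀) = p₀ := by
  obtain ⟨W, f, hW, h0, hf, rfl, hf_range⟩ := hD p₀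
  have hf_deriv : ∀ y ∈ W, HasMFDerivAt (𝓡 k) I f y (mfderiv (𝓡 k) I f y) := fun y hy =>
    ((hf.contMDiffAt (hW.mem_nhds hy)).mdifferentiableAt (by simp)).hasMFDerivAt
  have hρf_inv : (mfderiv (𝓡 k) I' (ρ ∘ f) 0).IsInvertible := by
    refine isInvertible_of_surjective_of_finrank_eq (F := EuclideanSpace ℝ (Fin k)) (G := V')
      (fun v => ?_) (finrank_euclideanSpace_fin.trans hk.symm)
    obtain ⟨u, hu⟩ : D.lift hDt hk (f 0) v ∈ LinearMap.range (mfderiv (𝓡 k) I f 0).toLinearMap :=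
      hf_range 0 h0 ▸ D.lift_mem hDt hk (f 0) v
    refine ⟨u, ?_⟩
    rw [((hρ.mdifferentiable (by simp) (f 0)).hasMFDerivAt.comp 0 (hf_deriv 0 h0)).mfderiv]
    exact (congrArg (mfderiv I I' ρ (f 0)) hu).trans (D.mfderiv_lift hDt hk (f 0) v)
  obtain ⟨U, σ, hU, h0U, hσ, hσW, hρfσ, hσ0⟩ :=
    exists_contMDiffOn_right_inverse_of_isInvertible_mfderiv (by simp) hW
      (hρ.comp_contMDiffOn hf) h0 hρf_inv
  have hfσ : IsLocalSection I I' ρ U (f ∘ σ) := ⟨hU, hf.comp hσ hσW, hρfσ⟩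
  refine ⟨U, f ∘ σ, hfσ.isIntegralSection hρ hk fun x hx => ?_, h0U, congrArg f hσ0⟩
  have hσ_deriv : HasMFDerivAt I' (𝓡 k) σ x (mfderiv I' (𝓡 k) σ x) :=
    ((hσ.contMDiffAt (hU.mem_nhds hx)).mdifferentiableAt (by simp)).hasMFDerivAt
  rw [((hf_deriv (σ x) (hσW hx)).comp x hσ_deriv).mfderiv]
  exact (LinearMap.range_comp_le_range _ _).trans (hf_range (σ x) (hσW hx)).le

theorem Distribution.IsIntegrable.forall_isIntegralSection_comp_iff [IsManifold I₁ ∞ N₁]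
    {D₁ : Distribution I₁ N₁ k} (hD : D.IsIntegrable) (hDt : D.IsTransverse I' ρ)
    (hρ : ContMDiff I I' ∞ ρ) (hk : Module.finrank ℝ V' = k) (hs : ContMDiff I I₁ ∞ s)
    (hρs : ∀ p, ρ₁ (s p) = ρ p) :
    (∀ (U : Set N') (γ : N' → N), D.IsIntegralSection I' ρ U γ →
      D₁.IsIntegralSection I' ρ₁ U (s ∘ γ)) ↔
    ∀ p, (D.space p).map (mfderiv I I₁ s p).toLinearMap = D₁.space (s p) := by
  refine ⟨fun h p => ?_, fun h U γ hγ => ?_⟩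
  · obtain ⟨U, γ, hγ, hpU, hγp⟩ := hD.exists_isIntegralSection hDt hρ hk p
    have hmap : (D.space (γ (ρ p))).map (mfderiv I I₁ s (γ (ρ p))).toLinearMap =
        D₁.space (s (γ (ρ p))) :=
      (hγ.range_mfderiv_comp hs hpU).symm.trans ((h U γ hγ).range_eq _ hpU)
    rwa [hγp] at hmap
  · have hγ_sec := hγ.isLocalSection
    exact ⟨⟨hγ_sec.isOpen, hs.comp_contMDiffOn hγ_sec.contMDiffOn,
      fun x hx => (hρs _).trans (hγ_sec.right_inv x hx)⟩,
      fun x hx => (hγ.range_mfderiv_comp hs hx).trans (h (γ x))⟩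

end IntegralSections

section Multivectors

variable {V : Type*} [NormedAddCommGroup V] [NormedSpace ℝ V] {H : Type*} [TopologicalSpace H]
  {I : ModelWithCorners ℝ V H} {N : Type*} [TopologicalSpace N] [ChartedSpace H N]
  {V' : Type*} [NormedAddCommGroup V'] [NormedSpace ℝ V'] {H' : Type*} [TopologicalSpace H']
  {I' : ModelWithCorners ℝ V' H'} {N' : Type*} [TopologicalSpace N'] [ChartedSpace H' N']
  [IsManifold I' ∞ N']
  {V₁ : Type*} [NormedAddCommGroup V₁] [NormedSpace ℝ V₁] {H₁ : Type*} [TopologicalSpace H₁]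
  {I₁ : ModelWithCorners ℝ V₁ H₁} {N₁ : Type*} [TopologicalSpace N₁] [ChartedSpace H₁ N₁]
  {k : ℕ} {ρ : N → N'}

/-- Local decomposability of a `k`-vector field `ξ` along a map `ρ : N → N'`, that is, of a family
`ξ p ∈ Λᵏ T_{ρ p} N'`: near every point, `ξ = Y₁ ∧ … ∧ Y_k` for smooth vector fields `Y_i` along
`ρ`. -/
def IsLocallyDecomposableAlong (I : ModelWithCorners ℝ V H) (I' : ModelWithCorners ℝ V' H')
    [IsManifold I' ∞ N'] (ρ : N → N') (ξ : ∀ p, ⋀[ℝ]^k (TangentSpace I' (ρ p))) : Prop :=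
  ∀ p₀ : N, ∃ U : Set N, IsOpen U ∧ p₀ ∈ U ∧ ∃ Y : Fin k → ∀ p : N, TangentSpace I' (ρ p),
    (∀ i, ContMDiffOn I I'.tangent ∞ (fun p => (⟨ρ p, Y i p⟩ : TangentBundle I' N')) U) ∧
      ∀ p ∈ U, ξ p = exteriorPower.ιMulti ℝ k fun i => Y i p

theorem IsLocallyDecomposable.comp {X : Multivectors I' N' k} (hX : IsLocallyDecomposable X)
    (hρ : ContMDiff I I' ∞ ρ) : IsLocallyDecomposableAlong I I' ρ fun p => X (ρ p) := by
  intro p₀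
  obtain ⟨U, hU, hp₀, Y, hY, hXY⟩ := hX (ρ p₀)
  exact ⟨ρ ⁻¹' U, hU.preimage hρ.continuous, hp₀, fun i p => Y i (ρ p),
    fun i => (hY i).comp hρ.contMDiffOn fun p hp => hp, fun p hp => hXY (ρ p) hp⟩

theorem IsLocallyDecomposableAlong.map_mfderiv [IsManifold I₁ ∞ N₁]
    {ξ : ∀ p, ⋀[ℝ]^k (TangentSpace I' (ρ p))}
    (hξ : IsLocallyDecomposableAlong I I' ρ ξ) {g : N' → N₁} (hg : ContMDiff I' I₁ ∞ g) :
    IsLocallyDecomposableAlong I I₁ (g ∘ ρ) fun p =>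
      exteriorPower.map k (mfderiv I' I₁ g (ρ p)).toLinearMap (ξ p) := by
  intro p₀
  obtain ⟨U, hU, hp₀, Y, hY, hξY⟩ := hξ p₀
  refine ⟨U, hU, hp₀, fun i p => mfderiv I' I₁ g (ρ p) (Y i p),
    fun i => (hg.contMDiff_tangentMap (m := ∞) le_rfl).comp_contMDiffOn (hY i), fun p hp => ?_⟩
  beta_reduce
  rw [hξY p hp, exteriorPower.map_apply_ιMulti]
  rfl

theorem exteriorPower_map_mfderiv_eq (X : Multivectors I N k) {g : N → N} (hg : ∀ p, g p = p)
    (p : N) : exteriorPower.map k (mfderiv I I g p).toLinearMap (X p) = X (g p) := by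
  obtain rfl : g = id := funext hg
  rw [mfderiv_id]
  exact DFunLike.congr_fun exteriorPower.map_id (X p)

variable [IsManifold I ∞ N]

theorem IsLocallyDecomposableAlong.isLocallyDecomposable {X : Multivectors I N k} {g : N → N}
    (hg : ∀ p, g p = p) (hX : IsLocallyDecomposableAlong I I g fun p => X (g p)) :
    IsLocallyDecomposable X := by
  obtain rfl : g = id := funext hg
  exact hX

theorem exists_ιMulti_eq_smul_ιMulti {U : Set N} {g : N → ℝ} (hg : ContMDiffOn I 𝓘(ℝ, ℝ) ∞ g U)
    {Y : Fin (k + 1) → ∀ p, TangentSpace I p} (hY : ∀ i, IsSmoothVectorFieldOn I (Y i) U) :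
    ∃ Z : Fin (k + 1) → ∀ p, TangentSpace I p, (∀ i, IsSmoothVectorFieldOn I (Z i) U) ∧
      ∀ p, exteriorPower.ιMulti ℝ (k + 1) (fun i => Z i p) =
        g p • exteriorPower.ιMulti ℝ (k + 1) fun i => Y i p := by
  refine ⟨Function.update Y 0 fun p => g p • Y 0 p, fun i => ?_, fun p => ?_⟩
  · rcases eq_or_ne i 0 with rfl | hi
    · rw [Function.update_self]
      exact hg.smul_section (hY 0)
    · rw [Function.update_of_ne hi]
      exact hY i
  · have hupdate : (fun i => Function.update Y 0 (fun p => g p • Y 0 p) i p) =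
        Function.update (fun i => Y i p) 0 (g p • Y 0 p) :=
      funext fun i => Function.apply_update (fun _ v => v p) Y 0 _ i
    rw [hupdate, AlternatingMap.map_update_smul, Function.update_eq_self]

section VolumeForm

variable {η : Forms I' N' k}

theorem IsVolumeForm.apply_basis_ne_zero (hη : IsVolumeForm η) {x : N'}
    (b : Module.Basis (Fin k) ℝ (TangentSpace I' x)) : η x b ≠ 0 :=
  ((η x).toAlternatingMap.map_basis_ne_zero_iff b).2 fun h0 => hη.ne_zero x
    (ContinuousAlternatingMap.toAlternatingMap_injective h0)

variable [FiniteDimensional ℝ V']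

theorem IsVolumeForm.alternatingMapLinearEquiv_bijective (hη : IsVolumeForm η)
    (hk : Module.finrank ℝ V' = k) (x : N') :
    Function.Bijective (exteriorPower.alternatingMapLinearEquiv (η x).toAlternatingMap) :=
  haveI : FiniteDimensional ℝ (TangentSpace I' x) := inferInstanceAs (FiniteDimensional ℝ V')
  HJ.alternatingMapLinearEquiv_bijective hk fun h0 => hη.ne_zero x
    (ContinuousAlternatingMap.toAlternatingMap_injective h0)

theorem IsVolumeForm.isLocallyDecomposable_of_apply_eq_one {η : Forms I' N' (k + 1)}
    (hη : IsVolumeForm η) (hk : Module.finrank ℝ V' = k + 1) {X : Multivectors I' N' (k + 1)}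
    (hX : ∀ x, exteriorPower.alternatingMapLinearEquiv (η x).toAlternatingMap (X x) = 1) :
    IsLocallyDecomposable X := by
  intro x₀
  let b : Module.Basis (Fin (k + 1)) ℝ V' := Module.finBasisOfFinrankEq ℝ V' hk
  let e := trivializationAt V' (TangentSpace I') x₀
  have hL : ∀ i, IsSmoothVectorFieldOn I' (e.localFrame b i) e.baseSet := fun i =>
    e.contMDiffOn_localFrame_baseSet ∞ b i
  have hηL : ∀ x ∈ e.baseSet, η x (fun i => e.localFrame b i x) ≠ 0 := fun x hx => by
    simpa only [e.localFrame_apply_of_mem_baseSet b hx] using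
      hη.apply_basis_ne_zero (e.basisAt b hx)
  obtain ⟨Y, hY, hYL⟩ := exists_ιMulti_eq_smul_ιMulti
    ((hη.smooth e.baseSet (e.localFrame b) e.open_baseSet hL).inv₀ hηL) hL
  refine ⟨e.baseSet, e.open_baseSet, FiberBundle.mem_baseSet_trivializationAt V' _ x₀, Y, hY,
    fun x hx => (hη.alternatingMapLinearEquiv_bijective hk x).injective ?_⟩
  rw [hX, hYL, map_smul, exteriorPower.alternatingMapLinearEquiv_apply_ιMulti]
  exact (inv_mul_cancel₀ (hηL x hx)).symm

theorem IsVolumeForm.exists_isLocallyDecomposable (hη : IsVolumeForm η)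
    (hk : Module.finrank ℝ V' = k) :
    ∃ X : Multivectors I' N' k, IsLocallyDecomposable X ∧ ∀ x, X x ≠ 0 := by
  cases k with
  | zero =>
    refine ⟨fun x => exteriorPower.ιMulti ℝ 0 0, fun x₀ => ⟨univ, isOpen_univ, mem_univ x₀,
      fun i => i.elim0, fun i => i.elim0, fun x _ => congrArg _ (Subsingleton.elim _ _)⟩,
      fun x h0 => one_ne_zero (α := ℝ) ?_⟩
    rw [← exteriorPower.zeroEquiv_ιMulti (R := ℝ) (M := TangentSpace I' x) 0]
    exact (congrArg _ h0).trans (map_zero _)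
  | succ k =>
    choose X hX using fun x => (hη.alternatingMapLinearEquiv_bijective hk x).surjective 1
    refine ⟨X, hη.isLocallyDecomposable_of_apply_eq_one hk hX, fun x h0 => zero_ne_one (α := ℝ) ?_⟩
    rw [← hX x, h0, map_zero]

end VolumeForm

end Multivectors

section Relatedness

variable {V : Type*} [NormedAddCommGroup V] [NormedSpace ℝ V] {H : Type*} [TopologicalSpace H]
  {I : ModelWithCorners ℝ V H} {N : Type*} [TopologicalSpace N] [ChartedSpace H N]
  {V' : Type*} [NormedAddCommGroup V'] [NormedSpace ℝ V'] {H' : Type*} [TopologicalSpace H']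
  {I' : ModelWithCorners ℝ V' H'} {N' : Type*} [TopologicalSpace N'] [ChartedSpace H' N']
  {V₁ : Type*} [NormedAddCommGroup V₁] [NormedSpace ℝ V₁] {H₁ : Type*} [TopologicalSpace H₁]
  {I₁ : ModelWithCorners ℝ V₁ H₁} {N₁ : Type*} [TopologicalSpace N₁] [ChartedSpace H₁ N₁]
  {k : ℕ} {ρ : N → N'} {q : N₁ → N} {s : N → N₁}

theorem exteriorPower_map_mfderiv_map_mfderiv {X : Multivectors I N k} (hq : ContMDiff I₁ I ∞ q)
    (hs : ContMDiff I I₁ ∞ s) (hqs : ∀ p, q (s p) = p) (p : N) :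
    exteriorPower.map k (mfderiv I₁ I q (s p)).toLinearMap
      (exteriorPower.map k (mfderiv I I₁ s p).toLinearMap (X p)) = X (q (s p)) := by
  rw [exteriorPower_map_map]
  refine Eq.trans ?_ (exteriorPower_map_mfderiv_eq X (g := q ∘ s) hqs p)
  rw [mfderiv_comp p (hq.mdifferentiable (by simp) _) (hs.mdifferentiable (by simp) _)]
  rfl

variable [IsManifold I ∞ N] [IsManifold I₁ ∞ N₁]

theorem IsLocallyDecomposable.of_comp_eq_map_mfderiv {X : Multivectors I N k}
    {X₁ : Multivectors I₁ N₁ k} (hX₁ : IsLocallyDecomposable X₁) (hq : ContMDiff I₁ I ∞ q)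
    (hs : ContMDiff I I₁ ∞ s) (hqs : ∀ p, q (s p) = p)
    (hX : ∀ p, X₁ (s p) = exteriorPower.map k (mfderiv I I₁ s p).toLinearMap (X p)) :
    IsLocallyDecomposable X := by
  have h := (hX₁.comp hs).map_mfderiv hq
  simp only [hX, exteriorPower_map_mfderiv_map_mfderiv hq hs hqs] at h
  exact h.isLocallyDecomposable hqs

namespace Distribution

variable {D : Distribution I N k} {D₁ : Distribution I₁ N₁ k}

theorem exists_mem_multivectorClass_of_map_mfderiv_eq (hq : ContMDiff I₁ I ∞ q)
    (hs : ContMDiff I I₁ ∞ s) (hqs : ∀ p, q (s p) = p)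
    (h : ∀ p, (D.space p).map (mfderiv I I₁ s p).toLinearMap = D₁.space (s p))
    {X₁ : Multivectors I₁ N₁ k} (hX₁ : X₁ ∈ D₁.multivectorClass) :
    ∃ X ∈ D.multivectorClass,
      ∀ p, X₁ (s p) = exteriorPower.map k (mfderiv I I₁ s p).toLinearMap (X p) := by
  have hpre : ∀ p, ∃ w ∈ exteriorSubmodule k (D.space p),
      exteriorPower.map k (mfderiv I I₁ s p).toLinearMap w = X₁ (s p) := fun p => by
    rw [← Submodule.mem_map, map_exteriorSubmodule, h p]
    exact hX₁.2.2 (s p)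
  choose X hXD hX using hpre
  refine ⟨X, ⟨hX₁.1.of_comp_eq_map_mfderiv hq hs hqs fun p => (hX p).symm, fun p h0 => ?_, hXD⟩,
    fun p => (hX p).symm⟩
  exact hX₁.2.1 (s p) (by rw [← hX, h0, map_zero])

theorem IsRelated.map_mfderiv_eq (hR : D.IsRelated D₁ s) (hne : D.multivectorClass.Nonempty)
    (p : N) : (D.space p).map (mfderiv I I₁ s p).toLinearMap = D₁.space (s p) := by
  obtain ⟨X, hX⟩ := hne
  obtain ⟨X₁, hX₁, hXX₁⟩ := hR.2 X hX
  have hmem : X₁ (s p) ∈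
      exteriorSubmodule k ((D.space p).map (mfderiv I I₁ s p).toLinearMap) := by
    rw [hXX₁, ← map_exteriorSubmodule]
    exact Submodule.mem_map_of_mem (hX.2.2 p)
  have hle : D₁.space (s p) ≤ (D.space p).map (mfderiv I I₁ s p).toLinearMap :=
    le_of_mem_exteriorSubmodule (D₁.finrank_space _).le (hX₁.2.1 (s p)) (hX₁.2.2 (s p)) hmem
  refine (Submodule.eq_of_le_of_finrank_le hle ?_).symm
  rw [D₁.finrank_space]
  exact (Submodule.finrank_map_le _ _).trans (D.finrank_space p).le

variable [FiniteDimensional ℝ V'] [IsManifold I' ∞ N']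

theorem lift_mem_multivectorClass (D : Distribution I N k) (hD : D.IsTransverse I' ρ)
    (hk : Module.finrank ℝ V' = k) (hρ : ContMDiff I I' ∞ ρ)
    {ξ : ∀ p, ⋀[ℝ]^k (TangentSpace I' (ρ p))} (hξ : IsLocallyDecomposableAlong I I' ρ ξ)
    (hξ0 : ∀ p, ξ p ≠ 0) :
    (fun p => exteriorPower.map k (D.lift hD hk p) (ξ p)) ∈ D.multivectorClass := by
  refine ⟨fun p₀ => ?_, fun p h0 => hξ0 p ?_, fun p => ?_⟩
  · obtain ⟨U, hU, hp₀, Y, hY, hξY⟩ := hξ p₀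
    refine ⟨U, hU, hp₀, fun i p => D.lift hD hk p (Y i p), fun i p hp =>
      (D.contMDiffAt_lift hD hk hρ ((hY i).contMDiffAt (hU.mem_nhds hp))).contMDiffWithinAt,
      fun p hp => ?_⟩
    beta_reduce
    rw [hξY p hp, exteriorPower.map_apply_ιMulti]
    rfl
  · exact exteriorPower.map_injective_field (D.lift_injective hD hk p) (h0.trans (map_zero _).symm)
  · refine exteriorPower_map_mem_exteriorSubmodule ?_ (ξ p)
    rintro _ ⟨v, rfl⟩
    exact D.lift_mem hD hk p v

theorem IsTransverse.exists_mem_multivectorClass_map_mfderiv_eq (hD : D.IsTransverse I' ρ)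
    (hD₁ : D₁.IsTransverse I' (ρ ∘ q)) (hk : Module.finrank ℝ V' = k) (hρ : ContMDiff I I' ∞ ρ)
    (hq : ContMDiff I₁ I ∞ q) (hs : ContMDiff I I₁ ∞ s) (hqs : ∀ p, q (s p) = p)
    (h : ∀ p, (D.space p).map (mfderiv I I₁ s p).toLinearMap = D₁.space (s p))
    {X : Multivectors I N k} (hX : X ∈ D.multivectorClass) :
    ∃ X₁ ∈ D₁.multivectorClass,
      ∀ p, X₁ (s p) = exteriorPower.map k (mfderiv I I₁ s p).toLinearMap (X p) := by
  let ξ : ∀ z, ⋀[ℝ]^k (TangentSpace I' (ρ (q z))) := fun z =>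
    exteriorPower.map k (mfderiv I I' ρ (q z)).toLinearMap (X (q z))
  have hξ : IsLocallyDecomposableAlong I₁ I' (ρ ∘ q) ξ := (hX.1.comp hq).map_mfderiv hρ
  have hξ0 : ∀ z, ξ z ≠ 0 := fun z h0 => hX.2.1 (q z) <|
    exteriorPower_map_injOn (hD.injOn_mfderiv (q z)) (hX.2.2 (q z)) (Submodule.zero_mem _)
      (h0.trans (map_zero _).symm)
  have hX₁ := D₁.lift_mem_multivectorClass hD₁ hk (hρ.comp hq) hξ hξ0
  refine ⟨_, hX₁, fun p => exteriorPower_map_injOn (hD₁.injOn_mfderiv (s p)) (hX₁.2.2 (s p)) ?_ ?_⟩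
  · rw [SetLike.mem_coe, ← h p, ← map_exteriorSubmodule]
    exact Submodule.mem_map_of_mem (hX.2.2 p)
  · have hlift : (mfderiv I₁ I' (ρ ∘ q) (s p)).toLinearMap ∘ₗ D₁.lift hD₁ hk (s p) =
        LinearMap.id := LinearMap.ext (D₁.mfderiv_lift hD₁ hk (s p))
    have hρq : (mfderiv I₁ I' (ρ ∘ q) (s p)).toLinearMap =
        (mfderiv I I' ρ (q (s p))).toLinearMap ∘ₗ (mfderiv I₁ I q (s p)).toLinearMap := by
      rw [mfderiv_comp (s p) (hρ.mdifferentiable (by simp) _) (hq.mdifferentiable (by simp) _)]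
      rfl
    calc exteriorPower.map k (mfderiv I₁ I' (ρ ∘ q) (s p)).toLinearMap
          (exteriorPower.map k (D₁.lift hD₁ hk (s p)) (ξ (s p)))
      _ = ξ (s p) := by
        rw [exteriorPower_map_map, hlift, exteriorPower.map_id, LinearMap.id_apply]
      _ = exteriorPower.map k (mfderiv I₁ I' (ρ ∘ q) (s p)).toLinearMap
          (exteriorPower.map k (mfderiv I I₁ s p).toLinearMap (X p)) := by
        rw [hρq, ← exteriorPower_map_map, exteriorPower_map_mfderiv_map_mfderiv hq hs hqs]

theorem multivectorClass_nonempty {η : Forms I' N' k} (hη : IsVolumeForm η)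
    (hk : Module.finrank ℝ V' = k) (hρ : ContMDiff I I' ∞ ρ) (hD : D.IsTransverse I' ρ) :
    D.multivectorClass.Nonempty := by
  obtain ⟨X, hX, hX0⟩ := hη.exists_isLocallyDecomposable hk
  exact ⟨_, D.lift_mem_multivectorClass hD hk hρ (hX.comp hρ) fun p => hX0 (ρ p)⟩

theorem isRelated_iff {η : Forms I' N' k} (hη : IsVolumeForm η) (hk : Module.finrank ℝ V' = k)
    (hρ : ContMDiff I I' ∞ ρ) (hq : ContMDiff I₁ I ∞ q) (hs : ContMDiff I I₁ ∞ s)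
    (hqs : ∀ p, q (s p) = p) (hD : D.IsTransverse I' ρ) (hD₁ : D₁.IsTransverse I' (ρ ∘ q)) :
    D.IsRelated D₁ s ↔
      ∀ p, (D.space p).map (mfderiv I I₁ s p).toLinearMap = D₁.space (s p) :=
  ⟨fun hR => hR.map_mfderiv_eq (multivectorClass_nonempty hη hk hρ hD), fun h =>
    ⟨fun _ => exists_mem_multivectorClass_of_map_mfderiv_eq hq hs hqs h,
      fun _ => hD.exists_mem_multivectorClass_map_mfderiv_eq hD₁ hk hρ hq hs hqs h⟩⟩

end Distribution

end Relatedness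

end HJ

theorem mainTheorem7_general {V : Type*} [NormedAddCommGroup V] [NormedSpace ℝ V]
    {H : Type*} [TopologicalSpace H] {I : ModelWithCorners ℝ V H}
    {N : Type*} [TopologicalSpace N] [ChartedSpace H N] [IsManifold I ∞ N]
    {V' : Type*} [NormedAddCommGroup V'] [NormedSpace ℝ V'] [FiniteDimensional ℝ V']
    {H' : Type*} [TopologicalSpace H'] {I' : ModelWithCorners ℝ V' H'}
    {N' : Type*} [TopologicalSpace N'] [ChartedSpace H' N'] [IsManifold I' ∞ N']
    {V₁ : Type*} [NormedAddCommGroup V₁] [NormedSpace ℝ V₁]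
    {H₁ : Type*} [TopologicalSpace H₁] {I₁ : ModelWithCorners ℝ V₁ H₁}
    {N₁ : Type*} [TopologicalSpace N₁] [ChartedSpace H₁ N₁] [IsManifold I₁ ∞ N₁]
    {k : ℕ} (hk : Module.finrank ℝ V' = k) {η : Forms I' N' k} (hη : IsVolumeForm η)
    {ρ : N → N'} (hρ : ContMDiff I I' ∞ ρ) {q : N₁ → N} (hq : ContMDiff I₁ I ∞ q)
    {s : N → N₁} (hs : ContMDiff I I₁ ∞ s) (hqs : ∀ p, q (s p) = p)
    {D₁ : Distribution I₁ N₁ k} (hD₁ : D₁.IsTransverse I' (ρ ∘ q))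
    {D : Distribution I N k} (hD : D.IsIntegrable) (hDt : D.IsTransverse I' ρ) :
    (∀ (U : Set N') (γ : N' → N), D.IsIntegralSection I' ρ U γ →
      D₁.IsIntegralSection I' (ρ ∘ q) U (s ∘ γ)) ↔ D.IsRelated D₁ s :=
  (hD.forall_isIntegralSection_comp_iff hDt hρ hk hs fun p => congrArg ρ (hqs p)).trans
    (Distribution.isRelated_iff hη hk hρ hq hs hqs hDt hD₁).symm

theorem mainTheorem7 {m n : ℕ} {M : Type*} {E : Type*}
    [TopologicalSpace M] [T2Space M] [SecondCountableTopology M]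
    [ChartedSpace (EuclideanSpace ℝ (Fin m)) M] [IsManifold (𝓡 m) ∞ M]
    [TopologicalSpace E] [T2Space E] [SecondCountableTopology E]
    [ChartedSpace (EuclideanSpace ℝ (Fin (m + n))) E] [IsManifold (𝓡 (m + n)) ∞ E]
    (π : E → M) [IsSmoothFiberBundle m n π]
    (η : Forms (𝓡 m) M m) (hη : IsVolumeForm η)
    (h : ReducedDual m n π → ExtendedDual m n π) (hh : IsHamiltonianSection m n h)
    (Dh : Distribution (redModel m n) (ReducedDual m n π) m)
    (hDh : SolvesHamiltonianProblem m n h Dh)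
    (s : E → ReducedDual m n π) (hs : ContMDiff (𝓡 (m + n)) (redModel m n) ∞ s)
    (hsec : ∀ u, (s u).proj = u)
    (D : Distribution (𝓡 (m + n)) E m) (hD : D.IsIntegrable) (hDt : D.IsTransverse (𝓡 m) π) :
    GeneralizedHJCondition m n Dh s D ↔ D.IsRelated Dh s :=
  mainTheorem7_general finrank_euclideanSpace_fin hη (IsSmoothFiberBundle.contMDiff π)
    (Bundle.contMDiff_proj _) hs hsec hDh.isTransverse hD hDt
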